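/- Let $k$ be an algebraically closed field and let $Q_2$ be the quiver with four vertices $b,-,+,e$ and four arrows $b\to -$, $b\to +$, $-\to e$, $+\to e$. Let $Rep_k(Q_2)$ be the abelian category of finite-dimensional $k$-representations of $Q_2$ (no commutativity relation is imposed). An object $X$ is called exceptional if $\dim_k \mathrm{Hom}(X,X)=1$ and $\mathrm{Ext}^n(X,X)=0$ for all $n\ge 1$. For $m\ge 0$ define linear maps $\pi_\pm^m:k^{m+1}\to k^m$ and $j_\pm^m:k^m\to k^{m+1}$ by $$\pi_+^m(a_1,\dots,a_{m+1})=(a_1,\dots,a_m),\qquad \pi_-^m(a_1,\dots,a_{m+1})=(a_2,\dots,a_{m+1}),$$ $$j_+^m(a_1,\dots,a_m)=(a_1,\dots,a_m,0),\qquad j_-^m(a_1,\dots,a_m)=(0,a_1,\dots,a_m).$$ Write a representation as $(V_b,V_-,V_+,V_e;\ f_{b-},f_{b+},f_{-e},f_{+e})$, where $f_{xy}:V_x\to V_y$ is the map along the arrow $x\to y$. For $m\ge 0$ put \begin{align*} E_1^m&=(k^{m+1},k^m,k^m,k^m;\ \pi_-^m,\pi_+^m,\mathrm{Id},\mathrm{Id}),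 & E_2^m&=(k^m,k^{m+1},k^{m+1},k^{m+1};\ j_-^m,j_+^m,\mathrm{Id},\mathrm{Id}),\\ E_3^m&=(k^m,k^m,k^m,k^{m+1};\ \mathrm{Id},\mathrm{Id},j_-^m,j_+^m), & E_4^m&=(k^{m+1},k^{m+1},k^{m+1},k^m;\ \mathrm{Id},\mathrm{Id},\pi_-^m,\pi_+^m),\\ E_5^m&=(k^m,k^{m+1},k^m,k^{m+1};\ j_-^m,\mathrm{Id},\mathrm{Id},j_+^m), & E_6^m&=(k^{m+1},k^m,k^{m+1},k^m;\ \pi_-^m,\mathrm{Id},\mathrm{Id},\pi_+^m),\\ E_7^m&=(k^{m+1},k^{m+1},k^m,k^m;\ \mathrm{Id},\pi_+^m,\pi_-^m,\mathrm{Id}), & E_8^m&=(k^m,k^m,k^{m+1},k^{m+1};\ \mathrm{Id},j_+^m,j_-^m,\mathrm{Id}), \end{align*} and \begin{align*} F_+&=(0,0,k,0;\ 0,0,0,0), & F_-&=(0,k,0,0;\ 0,0,0,0),\\ G_+&=(k,0,k,k;\ 0,\mathrm{Id},0,\mathrm{Id}), & G_-&=(k,k,0,k;\ \mathrm{Id},0,\mathrm{Id},0).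 \end{align*} Then an object of $Rep_k(Q_2)$ is exceptional if and only if it is isomorphic to one of $E_1^m,\dots,E_8^m$ ($m=0,1,2,\dots$), $F_+,F_-,G_+,G_-$; moreover, these representations are pairwise non-isomorphic. -/

import Mathlib

open CategoryTheory

universe v u

/-- The category `Rep_k(Q)` of finite-dimensional `k`-representations of a quiver `Q`, as the
category of functors from the path category of `Q` to finite-dimensional `k`-vector spaces. -/
abbrev QuiverRep (k : Type u) [Field k] (Q : Type) [Quiver.{0} Q] : Type (u + 1) :=
  Paths Q ⥤ FGModuleCat.{u} k

/-- An object `X` of a `k`-linear abelian category is exceptional if `Hom(X, X)` is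
one-dimensional over `k` and `Ext^n(X, X) = 0` for all `n ≥ 1`.  (The lemma `HasExt.standard`
only selects a universe in which the `Ext`-groups live.) -/
structure IsExceptional (k : Type*) [Field k] {C : Type u} [Category.{v} C] [Abelian C]
    [Linear k C] (X : C) : Prop where
  finrank_end : Module.finrank k (X ⟶ X) = 1
  ext_eq_zero : haveI : HasExt.{max u v} C := HasExt.standard C
    ∀ n : ℕ, 1 ≤ n → ∀ x : Abelian.Ext.{max u v} X X n, x = 0

/-- The vertices of the quiver `Q₂`: the source `b`, the two middle vertices `minus` and `plus`,
and the sink `e`. -/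
inductive Q2 : Type
  | b
  | minus
  | plus
  | e

namespace Q2

/-- The four arrows of `Q₂`, the square `plus → e`, `b → plus`, `minus → e`, `b → minus`. -/
inductive Arrow : Q2 → Q2 → Type
  | b_minus : Arrow b minus
  | b_plus : Arrow b plus
  | minus_e : Arrow minus e
  | plus_e : Arrow plus e

instance : Quiver.{0} Q2 where
  Hom := Arrow

section Representations

variable {k : Type u} [Field k]

/-- The dimensions of the four spaces of a representation. -/
def dimAt (αb αm αp αe : ℕ) : Q2 → ℕ
  | b => αb
  | minus => αm
  | plus => αp
  | e => αe

/-- The representation of `Q₂` with the spaces `k ^ αb`, `k ^ αm`, `k ^ αp`, `k ^ αe` at the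
vertices `b`, `minus`, `plus`, `e` and the given linear maps along the four arrows. -/
noncomputable def rep (αb αm αp αe : ℕ)
    (b_minus : (Fin αb → k) →ₗ[k] (Fin αm → k)) (b_plus : (Fin αb → k) →ₗ[k] (Fin αp → k))
    (minus_e : (Fin αm → k) →ₗ[k] (Fin αe → k)) (plus_e : (Fin αp → k) →ₗ[k] (Fin αe → k)) :
    QuiverRep k Q2 :=
  Paths.lift
    { obj := fun v => FGModuleCat.of k (Fin (dimAt αb αm αp αe v) → k)
      map := fun {_ _} a =>
        match a with
        | Arrow.b_minus => FGModuleCat.ofHom b_minus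
        | Arrow.b_plus => FGModuleCat.ofHom b_plus
        | Arrow.minus_e => FGModuleCat.ofHom minus_e
        | Arrow.plus_e => FGModuleCat.ofHom plus_e }

variable (k)

/-- `π₊(a₁, …, aₘ, aₘ₊₁) = (a₁, …, aₘ)`. -/
def piPlus (m : ℕ) : (Fin (m + 1) → k) →ₗ[k] (Fin m → k) where
  toFun a := fun i => a i.castSucc
  map_add' _ _ := rfl
  map_smul' _ _ := rfl

/-- `π₋(a₁, a₂, …, aₘ₊₁) = (a₂, …, aₘ₊₁)`. -/
def piMinus (m : ℕ) : (Fin (m + 1) → k) →ₗ[k] (Fin m → k) where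
  toFun a := fun i => a i.succ
  map_add' _ _ := rfl
  map_smul' _ _ := rfl

/-- `j₊(a₁, …, aₘ) = (a₁, …, aₘ, 0)`. -/
def jPlus (m : ℕ) : (Fin m → k) →ₗ[k] (Fin (m + 1) → k) where
  toFun a := Fin.snoc (α := fun _ => k) a 0
  map_add' x y := by
    ext i
    refine Fin.lastCases ?_ (fun i => ?_) i <;> simp
  map_smul' c x := by
    ext i
    refine Fin.lastCases ?_ (fun i => ?_) i <;> simp

/-- `j₋(a₁, …, aₘ) = (0, a₁, …, aₘ)`. -/
def jMinus (m : ℕ) : (Fin m → k) →ₗ[k] (Fin (m + 1) → k) where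
  toFun a := Fin.cons (α := fun _ => k) 0 a
  map_add' x y := by
    ext i
    refine Fin.cases ?_ (fun i => ?_) i <;> simp
  map_smul' c x := by
    ext i
    refine Fin.cases ?_ (fun i => ?_) i <;> simp

noncomputable def E1 (m : ℕ) : QuiverRep k Q2 :=
  rep (m + 1) m m m (b_minus := piMinus k m) (b_plus := piPlus k m)
    (minus_e := LinearMap.id) (plus_e := LinearMap.id)

noncomputable def E2 (m : ℕ) : QuiverRep k Q2 :=
  rep m (m + 1) (m + 1) (m + 1) (b_minus := jMinus k m) (b_plus := jPlus k m)
    (minus_e := LinearMap.id) (plus_e := LinearMap.id)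

noncomputable def E3 (m : ℕ) : QuiverRep k Q2 :=
  rep m m m (m + 1) (b_minus := LinearMap.id) (b_plus := LinearMap.id)
    (minus_e := jMinus k m) (plus_e := jPlus k m)

noncomputable def E4 (m : ℕ) : QuiverRep k Q2 :=
  rep (m + 1) (m + 1) (m + 1) m (b_minus := LinearMap.id) (b_plus := LinearMap.id)
    (minus_e := piMinus k m) (plus_e := piPlus k m)

noncomputable def E5 (m : ℕ) : QuiverRep k Q2 :=
  rep m (m + 1) m (m + 1) (b_minus := jMinus k m) (b_plus := LinearMap.id)
    (minus_e := LinearMap.id) (plus_e := jPlus k m)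

noncomputable def E6 (m : ℕ) : QuiverRep k Q2 :=
  rep (m + 1) m (m + 1) m (b_minus := piMinus k m) (b_plus := LinearMap.id)
    (minus_e := LinearMap.id) (plus_e := piPlus k m)

noncomputable def E7 (m : ℕ) : QuiverRep k Q2 :=
  rep (m + 1) (m + 1) m m (b_minus := LinearMap.id) (b_plus := piPlus k m)
    (minus_e := piMinus k m) (plus_e := LinearMap.id)

noncomputable def E8 (m : ℕ) : QuiverRep k Q2 :=
  rep m m (m + 1) (m + 1) (b_minus := LinearMap.id) (b_plus := jPlus k m)
    (minus_e := jMinus k m) (plus_e := LinearMap.id)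

noncomputable def FPlus : QuiverRep k Q2 :=
  rep 0 0 1 0 (b_minus := 0) (b_plus := 0) (minus_e := 0) (plus_e := 0)

noncomputable def FMinus : QuiverRep k Q2 :=
  rep 0 1 0 0 (b_minus := 0) (b_plus := 0) (minus_e := 0) (plus_e := 0)

noncomputable def GPlus : QuiverRep k Q2 :=
  rep 1 0 1 1 (b_minus := 0) (b_plus := LinearMap.id) (minus_e := 0) (plus_e := LinearMap.id)

noncomputable def GMinus : QuiverRep k Q2 :=
  rep 1 1 0 1 (b_minus := LinearMap.id) (b_plus := 0) (minus_e := LinearMap.id) (plus_e := 0)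

/-- The labels of the representations in the list. -/
inductive ExcLabel : Type
  | E1 (m : ℕ)
  | E2 (m : ℕ)
  | E3 (m : ℕ)
  | E4 (m : ℕ)
  | E5 (m : ℕ)
  | E6 (m : ℕ)
  | E7 (m : ℕ)
  | E8 (m : ℕ)
  | FPlus
  | FMinus
  | GPlus
  | GMinus

/-- The representation with a given label. -/
noncomputable def excRep : ExcLabel → QuiverRep k Q2
  | .E1 m => E1 k m
  | .E2 m => E2 k m
  | .E3 m => E3 k m
  | .E4 m => E4 k m
  | .E5 m => E5 k m
  | .E6 m => E6 k m
  | .E7 m => E7 k m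
  | .E8 m => E8 k m
  | .FPlus => FPlus k
  | .FMinus => FMinus k
  | .GPlus => GPlus k
  | .GMinus => GMinus k

end Representations

end Q2

namespace Q2

/-! The category is hereditary: every `X` has a two-term projective resolution, with one free
summand for each vertex and one for each arrow. Hence all `Ext^n(X, X)` with `n ≥ 1` vanish exactly
when the commutator map from families of endomorphisms of the `X_v` to families of maps `X_v → X_w`
along the arrows is onto (`isExceptional_iff_rigid`). The kernel of this map is `End X`, so by
rank–nullity `X` is exceptional if and only if `End X` is one-dimensional and the Tits form takes
the value 1 at the dimension vector (`isExceptional_iff`).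

Twice the Tits form is the sum of the squared differences of dimensions along the four edges of the
cycle. At value 1, exactly two edges carry a jump of size one, and the other two have none
(`roots`). Rigidity makes every arrow injective or surjective, hence bijective where there is no
jump.

If the jumps lie on different paths from `b` to `e`, each path has a bijective arrow, and `X`
amounts to the pencil of its two composites, between spaces whose dimensions differ by one. Rigidity
gives every nonzero combination maximal rank (`Rigid.pencil`), and over an algebraically closed
field such a pencil has the unique normal form `(π₋, π₊)` or `(j₋, j₊)`
(`SurjectivePencil.exists_chain`). The positions of the jumps then select one of the eight families.

If both jumps lie on one path, the other path is invertible, and travelling once round the square is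
an endomorphism of `X`. It is a scalar, the jump forces this scalar to be 0, and maximal rank then
makes the smaller dimension 0 (`middle_degenerate`). This leaves `F±` and `G±`.

Conversely, an endomorphism of a listed family member has a Toeplitz matrix with zero off-diagonal
entries (`toeplitz`), so it is scalar. The dimension vectors are pairwise distinct, which separates
the list. -/

lemma arrow_cases {P : ∀ v w : Q2, (v ⟶ w) → Prop} (h₁ : P b minus Arrow.b_minus)
    (h₂ : P b plus Arrow.b_plus) (h₃ : P minus e Arrow.minus_e) (h₄ : P plus e Arrow.plus_e)
    (v w : Q2) (a : v ⟶ w) : P v w a :=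
  match v, w, a with
  | _, _, Arrow.b_minus => h₁
  | _, _, Arrow.b_plus => h₂
  | _, _, Arrow.minus_e => h₃
  | _, _, Arrow.plus_e => h₄

/-! ### Representations and their morphisms, vertex by vertex -/

section Morphisms

variable {k : Type u} [Field k]

/-- The space of a representation at a vertex. -/
abbrev space (X : QuiverRep k Q2) (v : Q2) : FGModuleCat.{u} k := X.obj ((Paths.of Q2).obj v)

/-- The linear map of a representation along an arrow. -/
def arrowMap (X : QuiverRep k Q2) {v w : Q2} (a : v ⟶ w) : space X v →ₗ[k] space X w :=
  (X.map ((Paths.of Q2).map a)).hom.hom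

/-- The linear map at a vertex of a morphism of representations. -/
def component {X Y : QuiverRep k Q2} (g : X ⟶ Y) (v : Q2) : space X v →ₗ[k] space Y v :=
  (g.app ((Paths.of Q2).obj v)).hom.hom

lemma component_arrowMap {X Y : QuiverRep k Q2} (g : X ⟶ Y) {v w : Q2} (a : v ⟶ w)
    (x : space X v) :
    component g w (arrowMap X a x) = arrowMap Y a (component g v x) := by
  have := g.naturality ((Paths.of Q2).map a)
  exact LinearMap.congr_fun (congrArg (fun f => f.hom.hom) this) x

/-- A morphism of representations from linear maps at the vertices commuting with the arrows. -/
def homMk {X Y : QuiverRep k Q2} (g : ∀ v : Q2, space X v →ₗ[k] space Y v)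
    (hg : ∀ (v w : Q2) (a : v ⟶ w) (x : space X v),
      g w (arrowMap X a x) = arrowMap Y a (g v x)) : X ⟶ Y where
  app v := FGModuleCat.ofHom (g v)
  naturality := by
    intro v w p
    induction p using Paths.induction with
    | id => simp
    | comp p q ih =>
      rw [X.map_comp, Y.map_comp, Category.assoc, ← reassoc_of% ih]
      congr 1
      ext1
      exact LinearMap.ext (hg _ _ q)

@[simp] lemma component_homMk {X Y : QuiverRep k Q2} (g : ∀ v : Q2, space X v →ₗ[k] space Y v)
    (hg : ∀ (v w : Q2) (a : v ⟶ w) (x : space X v),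
      g w (arrowMap X a x) = arrowMap Y a (g v x)) (v : Q2) :
    component (homMk g hg) v = g v := rfl

lemma hom_ext {X Y : QuiverRep k Q2} {f g : X ⟶ Y}
    (h : ∀ v x, component f v x = component g v x) : f = g := by
  apply NatTrans.ext
  funext v
  ext1
  exact LinearMap.ext (h v)

@[simp] lemma component_zero {X Y : QuiverRep k Q2} (v : Q2) :
    component (0 : X ⟶ Y) v = 0 := rfl

@[simp] lemma component_id (X : QuiverRep k Q2) (v : Q2) :
    component (𝟙 X) v = LinearMap.id := rfl

@[simp] lemma component_comp {X Y Z : QuiverRep k Q2} (f : X ⟶ Y) (g : Y ⟶ Z) (v : Q2)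
    (x : space X v) : component (f ≫ g) v x = component g v (component f v x) := rfl

lemma component_surjective {X Y : QuiverRep k Q2} (f : X ⟶ Y) [Epi f] (v : Q2) :
    Function.Surjective (component f v) := by
  have : Epi (f.app ((Paths.of Q2).obj v)) := inferInstance
  have : Epi ((forget₂ (FGModuleCat k) (ModuleCat k)).map (f.app ((Paths.of Q2).obj v))) :=
    inferInstance
  exact (ModuleCat.epi_iff_surjective _).1 this

/-- A family of bijective linear maps commuting with the arrows gives an isomorphism. -/
lemma nonempty_iso {X Y : QuiverRep k Q2} (g : ∀ v : Q2, space X v ≃ₗ[k] space Y v)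
    (hg : ∀ (v w : Q2) (a : v ⟶ w) (x : space X v),
      g w (arrowMap X a x) = arrowMap Y a (g v x)) : Nonempty (X ≅ Y) :=
  ⟨{ hom := homMk (fun v => (g v).toLinearMap) hg
     inv := homMk (fun v => (g v).symm.toLinearMap) (by
      intro v w a x
      obtain ⟨x, rfl⟩ := (g v).surjective x
      simp [← hg])
     hom_inv_id := hom_ext (by simp)
     inv_hom_id := hom_ext (by simp) }⟩

/-- A complex of representations that splits at each vertex is a short exact sequence. -/
lemma shortExact_of_split (S : ShortComplex (QuiverRep k Q2))
    (r : ∀ v : Q2, space S.X₂ v →ₗ[k] space S.X₁ v) (s : ∀ v : Q2, space S.X₃ v →ₗ[k] space S.X₂ v)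
    (hr : ∀ v x, r v (component S.f v x) = x) (hs : ∀ v x, component S.g v (s v x) = x)
    (hrs : ∀ v x, component S.f v (r v x) + s v (component S.g v x) = x) : S.ShortExact := by
  have : Mono S.f := ⟨fun g h e => hom_ext fun v x => by
    rw [← hr v (component g v x), ← hr v (component h v x), ← component_comp, e, component_comp]⟩
  have : Epi S.g := ⟨fun g h e => hom_ext fun v x => by
    rw [← hs v x, ← component_comp, e, component_comp]⟩
  -- The retraction `r` need not commute with the arrows. On vectors killed by `S.g` it inverts
  -- `S.f`, which is why `r` after `h` is a morphism of representations.
  have key {A : QuiverRep k Q2} (h : A ⟶ S.X₂) (w : h ≫ S.g = 0) (v : Q2) (x : space A v) :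
      component S.f v (r v (component h v x)) = component h v x := by
    have := hrs v (component h v x)
    rwa [← component_comp, w, component_zero, LinearMap.zero_apply, map_zero, add_zero] at this
  refine ⟨ShortComplex.exact_of_f_is_kernel _ (Limits.KernelFork.IsLimit.ofι' _ _ fun {A} h w =>
    ⟨homMk (fun v => r v ∘ₗ component h v) fun v w' a x => ?_, hom_ext fun v x => ?_⟩)⟩
  · simp only [LinearMap.comp_apply]
    rw [component_arrowMap, ← key h w v x, ← component_arrowMap, hr, key h w v x]
  · exact key h w v x

end Morphisms

/-! ### Free representations and their projectivity -/

section Resolution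

variable {k : Type u} [Field k]

/-- The spaces of the projective representation generated by the spaces `V v`. -/
def freeSpace (V : Q2 → FGModuleCat.{u} k) : Q2 → FGModuleCat.{u} k
  | b => V b
  | minus => FGModuleCat.of k (V b × V minus)
  | plus => FGModuleCat.of k (V b × V plus)
  -- The two copies of `V b` belong to the two paths from `b` to `e`, which are distinct because the
  -- square is not assumed to commute.
  | e => FGModuleCat.of k ((V b × V b) × (V minus × V plus) × V e)

/-- The projective representation generated by the spaces `V v`. -/
noncomputable def free (V : Q2 → FGModuleCat.{u} k) : QuiverRep k Q2 :=
  Paths.lift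
    { obj := freeSpace V
      map := fun {_ _} a =>
        match a with
        | Arrow.b_minus => FGModuleCat.ofHom (LinearMap.inl k (V b) (V minus))
        | Arrow.b_plus => FGModuleCat.ofHom (LinearMap.inl k (V b) (V plus))
        | Arrow.minus_e => FGModuleCat.ofHom
            ((LinearMap.inl k (V b) (V b)).prodMap
              (LinearMap.inl k (V minus × V plus) (V e) ∘ₗ LinearMap.inl k (V minus) (V plus)))
        | Arrow.plus_e => FGModuleCat.ofHom
            ((LinearMap.inr k (V b) (V b)).prodMap
              (LinearMap.inl k (V minus × V plus) (V e) ∘ₗ LinearMap.inr k (V minus) (V plus))) }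

variable (V : Q2 → FGModuleCat.{u} k)

/-- The inclusion of the generators. -/
noncomputable def gen : ∀ v : Q2, V v →ₗ[k] space (free V) v
  | b => (LinearMap.id : V b →ₗ[k] V b)
  | minus => LinearMap.inr k (V b) (V minus)
  | plus => LinearMap.inr k (V b) (V plus)
  | e => LinearMap.inr k (V b × V b) ((V minus × V plus) × V e) ∘ₗ
      LinearMap.inr k (V minus × V plus) (V e)

variable {V}

/-- The components of the morphism with given values on the generators. -/
def liftComponent {Y : QuiverRep k Q2} (g : ∀ v : Q2, V v →ₗ[k] space Y v) :
    ∀ v : Q2, space (free V) v →ₗ[k] space Y v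
  | b => g b
  | minus => (arrowMap Y Arrow.b_minus ∘ₗ g b).coprod (g minus)
  | plus => (arrowMap Y Arrow.b_plus ∘ₗ g b).coprod (g plus)
  | e => ((arrowMap Y Arrow.minus_e ∘ₗ arrowMap Y Arrow.b_minus ∘ₗ g b).coprod
        (arrowMap Y Arrow.plus_e ∘ₗ arrowMap Y Arrow.b_plus ∘ₗ g b)).coprod
      (((arrowMap Y Arrow.minus_e ∘ₗ g minus).coprod (arrowMap Y Arrow.plus_e ∘ₗ g plus)).coprod
        (g e))

section
variable {Y : QuiverRep k Q2} (g : ∀ v : Q2, V v →ₗ[k] space Y v)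

lemma liftComponent_minus (x : V b × V minus) :
    liftComponent g minus x = arrowMap Y Arrow.b_minus (g b x.1) + g minus x.2 := rfl

lemma liftComponent_plus (x : V b × V plus) :
    liftComponent g plus x = arrowMap Y Arrow.b_plus (g b x.1) + g plus x.2 := rfl

lemma liftComponent_e (x : (V b × V b) × (V minus × V plus) × V e) :
    liftComponent g e x =
      (arrowMap Y Arrow.minus_e (arrowMap Y Arrow.b_minus (g b x.1.1)) +
        arrowMap Y Arrow.plus_e (arrowMap Y Arrow.b_plus (g b x.1.2))) +
      (arrowMap Y Arrow.minus_e (g minus x.2.1.1) + arrowMap Y Arrow.plus_e (g plus x.2.1.2) +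
        g e x.2.2) := rfl

lemma liftComponent_gen (v : Q2) (x : V v) : liftComponent g v (gen V v x) = g v x := by
  cases v
  · rfl
  · exact (liftComponent_minus g (0, x)).trans (by simp)
  · exact (liftComponent_plus g (0, x)).trans (by simp)
  · exact (liftComponent_e g ((0, 0), (0, 0), x)).trans (by simp)

/-- The morphism with given values on the generators. -/
noncomputable def freeLift : free V ⟶ Y :=
  homMk (liftComponent g) (arrow_cases
    (fun x => (liftComponent_minus g (x, 0)).trans (by simp; rfl))
    (fun x => (liftComponent_plus g (x, 0)).trans (by simp; rfl))
    (fun (x : V b × V minus) => (liftComponent_e g ((x.1, 0), (x.2, 0), 0)).trans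
      (by rw [liftComponent_minus]; simp))
    (fun (x : V b × V plus) => (liftComponent_e g ((0, x.1), (0, x.2), 0)).trans
      (by rw [liftComponent_plus]; simp)))

@[simp] lemma component_freeLift_gen (v : Q2) (x : V v) :
    component (freeLift g) v (gen V v x) = g v x := liftComponent_gen g v x

end

lemma exists_eq_gen_minus (x : space (free V) minus) : ∃ (β : V b) (μ : V minus),
    x = arrowMap (free V) Arrow.b_minus (gen V b β) + gen V minus μ := by
  obtain ⟨β, μ⟩ : V b × V minus := x
  exact ⟨β, μ, (by simp : ((β, μ) : V b × V minus) = (β, 0) + (0, μ))⟩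

lemma exists_eq_gen_plus (x : space (free V) plus) : ∃ (β : V b) (ρ : V plus),
    x = arrowMap (free V) Arrow.b_plus (gen V b β) + gen V plus ρ := by
  obtain ⟨β, ρ⟩ : V b × V plus := x
  exact ⟨β, ρ, (by simp : ((β, ρ) : V b × V plus) = (β, 0) + (0, ρ))⟩

lemma exists_eq_gen_e (x : space (free V) e) :
    ∃ (β₁ β₂ : V b) (μ : V minus) (ρ : V plus) (ε : V e), x =
      arrowMap (free V) Arrow.minus_e (arrowMap (free V) Arrow.b_minus (gen V b β₁)) +
      arrowMap (free V) Arrow.plus_e (arrowMap (free V) Arrow.b_plus (gen V b β₂)) +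
      arrowMap (free V) Arrow.minus_e (gen V minus μ) +
      arrowMap (free V) Arrow.plus_e (gen V plus ρ) + gen V e ε := by
  obtain ⟨⟨β₁, β₂⟩, ⟨μ, ρ⟩, ε⟩ : (V b × V b) × (V minus × V plus) × V e := x
  exact ⟨β₁, β₂, μ, ρ, ε, (by simp :
    (((β₁, β₂), (μ, ρ), ε) : (V b × V b) × (V minus × V plus) × V e) =
      ((β₁, 0), (0, 0), 0) + ((0, β₂), (0, 0), 0) + ((0, 0), (μ, 0), 0) +
      ((0, 0), (0, ρ), 0) + ((0, 0), (0, 0), ε))⟩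

lemma free_hom_ext {Y : QuiverRep k Q2} {f g : free V ⟶ Y}
    (h : ∀ v x, component f v (gen V v x) = component g v (gen V v x)) : f = g := by
  refine hom_ext fun v x => ?_
  cases v
  · exact h b x
  · obtain ⟨β, μ, rfl⟩ := exists_eq_gen_minus x
    simp only [map_add, component_arrowMap, h]
  · obtain ⟨β, ρ, rfl⟩ := exists_eq_gen_plus x
    simp only [map_add, component_arrowMap, h]
  · obtain ⟨β₁, β₂, μ, ρ, ε, rfl⟩ := exists_eq_gen_e x
    simp only [map_add, component_arrowMap, h]

/-- Values on generators can be prescribed freely, so it is enough to lift them linearly through the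
surjection at each vertex, with no compatibility to check. -/
instance : Projective (free V) where
  factors {A B} f g hg := by
    choose l hl using fun v => (component g v).exists_rightInverse_of_surjective
      (LinearMap.range_eq_top.2 (component_surjective g v))
    refine ⟨freeLift fun v => l v ∘ₗ component f v ∘ₗ gen V v, free_hom_ext fun v x => ?_⟩
    rw [component_comp, component_freeLift_gen]
    exact LinearMap.congr_fun (hl v) _

end Resolution
-- The two-term projective resolution
section StandardResolution

variable {k : Type u} [Field k] (X : QuiverRep k Q2)

/-- The generators of the relations of a representation: one space for each arrow, placed at the
target of the arrow. -/
def relationSpace : Q2 → FGModuleCat.{u} k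
  | b => FGModuleCat.of k PUnit
  | minus => space X b
  | plus => space X b
  | e => FGModuleCat.of k (space X minus × space X plus)

/-- The relation `a · x - X(a) x` attached to an arrow `a` and a vector `x` at its source. -/
noncomputable def arrowRelation {v w : Q2} (a : v ⟶ w) :
    space X v →ₗ[k] space (free (space X)) w :=
  arrowMap (free (space X)) a ∘ₗ gen (space X) v - gen (space X) w ∘ₗ arrowMap X a

lemma arrowRelation_apply {v w : Q2} (a : v ⟶ w) (x : space X v) : arrowRelation X a x =
    arrowMap (free (space X)) a (gen (space X) v x) - gen (space X) w (arrowMap X a x) := rfl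

/-- The relations of a representation. -/
noncomputable def relation : ∀ v : Q2, relationSpace X v →ₗ[k] space (free (space X)) v
  | b => 0
  | minus => arrowRelation X Arrow.b_minus
  | plus => arrowRelation X Arrow.b_plus
  | e => (arrowRelation X Arrow.minus_e).coprod (arrowRelation X Arrow.plus_e)

/-- The generators of the relations attached to the arrow `b → minus`. -/
noncomputable def relBMinus : space X b →ₗ[k] space (free (relationSpace X)) minus :=
  gen (relationSpace X) minus

/-- The generators of the relations attached to the arrow `b → plus`. -/
noncomputable def relBPlus : space X b →ₗ[k] space (free (relationSpace X)) plus :=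
  gen (relationSpace X) plus

/-- The generators of the relations attached to the arrow `minus → e`. -/
noncomputable def relMinusE : space X minus →ₗ[k] space (free (relationSpace X)) e :=
  gen (relationSpace X) e ∘ₗ LinearMap.inl k (space X minus) (space X plus)

/-- The generators of the relations attached to the arrow `plus → e`. -/
noncomputable def relPlusE : space X plus →ₗ[k] space (free (relationSpace X)) e :=
  gen (relationSpace X) e ∘ₗ LinearMap.inr k (space X minus) (space X plus)

variable {X}

lemma free_relation_b (x : space (free (relationSpace X)) b) : x = 0 :=
  Subsingleton.elim (α := PUnit) _ _

lemma exists_eq_relBMinus (x : space (free (relationSpace X)) minus) : ∃ β, x = relBMinus X β := by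
  obtain ⟨β, μ, rfl⟩ := exists_eq_gen_minus x
  exact ⟨μ, by rw [free_relation_b (gen (relationSpace X) b β), map_zero, zero_add]; rfl⟩

lemma exists_eq_relBPlus (x : space (free (relationSpace X)) plus) : ∃ β, x = relBPlus X β := by
  obtain ⟨β, μ, rfl⟩ := exists_eq_gen_plus x
  exact ⟨μ, by rw [free_relation_b (gen (relationSpace X) b β), map_zero, zero_add]; rfl⟩

lemma exists_eq_relE (x : space (free (relationSpace X)) e) : ∃ β₁ β₂ μ ρ, x =
    arrowMap _ Arrow.minus_e (relBMinus X β₁) + arrowMap _ Arrow.plus_e (relBPlus X β₂) +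
    (relMinusE X μ + relPlusE X ρ) := by
  obtain ⟨γ₁, γ₂, β₁, β₂, y, rfl⟩ := exists_eq_gen_e x
  obtain ⟨μ, ρ⟩ : space X minus × space X plus := y
  refine ⟨β₁, β₂, μ, ρ, ?_⟩
  rw [free_relation_b (gen (relationSpace X) b γ₁), free_relation_b (gen (relationSpace X) b γ₂)]
  simp only [map_zero, zero_add]
  congr 1
  exact (congrArg (gen (relationSpace X) e)
    (by simp : ((μ, ρ) : space X minus × space X plus) = (μ, 0) + (0, ρ))).trans
    (map_add (gen (relationSpace X) e) _ _)

section
variable {Y : QuiverRep k Q2} (g : ∀ v, relationSpace X v →ₗ[k] space Y v)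

lemma freeLift_relBMinus (β : space X b) :
    component (freeLift g) minus (relBMinus X β) = g minus β :=
  component_freeLift_gen g minus β

lemma freeLift_relBPlus (β : space X b) :
    component (freeLift g) plus (relBPlus X β) = g plus β :=
  component_freeLift_gen g plus β

lemma freeLift_relMinusE (μ : space X minus) :
    component (freeLift g) e (relMinusE X μ) = g e ((μ, 0) : space X minus × space X plus) :=
  component_freeLift_gen g e _

lemma freeLift_relPlusE (ρ : space X plus) :
    component (freeLift g) e (relPlusE X ρ) = g e ((0, ρ) : space X minus × space X plus) :=
  component_freeLift_gen g e _

end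

lemma relation_hom_ext {Y : QuiverRep k Q2} {f g : free (relationSpace X) ⟶ Y}
    (h₁ : ∀ x, component f minus (relBMinus X x) = component g minus (relBMinus X x))
    (h₂ : ∀ x, component f plus (relBPlus X x) = component g plus (relBPlus X x))
    (h₃ : ∀ x, component f e (relMinusE X x) = component g e (relMinusE X x))
    (h₄ : ∀ x, component f e (relPlusE X x) = component g e (relPlusE X x)) : f = g := by
  refine hom_ext fun v x => ?_
  cases v
  · rw [free_relation_b x, map_zero, map_zero]
  · obtain ⟨β, rfl⟩ := exists_eq_relBMinus x
    exact h₁ β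
  · obtain ⟨β, rfl⟩ := exists_eq_relBPlus x
    exact h₂ β
  · obtain ⟨β₁, β₂, μ, ρ, rfl⟩ := exists_eq_relE x
    simp only [map_add, component_arrowMap, h₁, h₂, h₃, h₄]

variable (X)

/-- The inclusion of the relations into the generators. -/
noncomputable def relationHom : free (relationSpace X) ⟶ free (space X) := freeLift (relation X)

lemma relationHom_relBMinus (x : space X b) :
    component (relationHom X) minus (relBMinus X x) = arrowRelation X Arrow.b_minus x :=
  freeLift_relBMinus _ x

lemma relationHom_relBPlus (x : space X b) :
    component (relationHom X) plus (relBPlus X x) = arrowRelation X Arrow.b_plus x :=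
  freeLift_relBPlus _ x

lemma relationHom_relMinusE (x : space X minus) :
    component (relationHom X) e (relMinusE X x) = arrowRelation X Arrow.minus_e x :=
  (freeLift_relMinusE _ x).trans (LinearMap.coprod_apply _ _ (x, 0) |>.trans (by simp))

lemma relationHom_relPlusE (x : space X plus) :
    component (relationHom X) e (relPlusE X x) = arrowRelation X Arrow.plus_e x :=
  (freeLift_relPlusE _ x).trans (LinearMap.coprod_apply _ _ (0, x) |>.trans (by simp))

/-- The standard projective resolution of a representation. -/
noncomputable def resolution : ShortComplex (QuiverRep k Q2) where
  X₁ := free (relationSpace X)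
  X₂ := free (space X)
  X₃ := X
  f := relationHom X
  g := freeLift fun _ => LinearMap.id
  zero := by
    apply relation_hom_ext <;> intro x <;>
    simp [relationHom_relBMinus, relationHom_relBPlus, relationHom_relMinusE,
      relationHom_relPlusE, arrowRelation_apply, component_arrowMap]

/-- A retraction of the relations into the generators at each vertex. -/
noncomputable def retraction : ∀ v : Q2,
    space (free (space X)) v →ₗ[k] space (free (relationSpace X)) v
  | b => 0
  | minus => (relBMinus X).coprod (0 : space X minus →ₗ[k] _)
  | plus => (relBPlus X).coprod (0 : space X plus →ₗ[k] _)
  -- A path of length two is reduced one arrow at a time: `a₂a₁x - X(a₂)X(a₁)x` is `a₂` applied to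
  -- the relation of `a₁` at `x`, plus the relation of `a₂` at `X(a₁)x`.
  | e => ((arrowMap (free (relationSpace X)) Arrow.minus_e ∘ₗ relBMinus X +
        relMinusE X ∘ₗ arrowMap X Arrow.b_minus).coprod
       (arrowMap (free (relationSpace X)) Arrow.plus_e ∘ₗ relBPlus X +
        relPlusE X ∘ₗ arrowMap X Arrow.b_plus)).coprod
      (((relMinusE X).coprod (relPlusE X)).coprod (0 : space X e →ₗ[k] _))

/-- At each vertex the sequence splits: `gen` is a section of the evaluation map, and `retraction`
records the relations used in reducing a path applied to a vector to its value. The equations `r1`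
to `r9` give the retraction on a spanning set. -/
lemma resolution_shortExact : (resolution X).ShortExact := by
  have r1 (β : space X b) : retraction X minus (arrowMap (free (space X)) Arrow.b_minus
      (gen (space X) b β)) = relBMinus X β :=
    (LinearMap.coprod_apply _ _ (β, 0)).trans (by simp)
  have r2 (μ : space X minus) : retraction X minus (gen (space X) minus μ) = 0 :=
    (LinearMap.coprod_apply _ _ (0, μ)).trans (by simp)
  have r3 (β : space X b) : retraction X plus (arrowMap (free (space X)) Arrow.b_plus
      (gen (space X) b β)) = relBPlus X β :=
    (LinearMap.coprod_apply _ _ (β, 0)).trans (by simp)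
  have r4 (μ : space X plus) : retraction X plus (gen (space X) plus μ) = 0 :=
    (LinearMap.coprod_apply _ _ (0, μ)).trans (by simp)
  have r5 (β : space X b) : retraction X e (arrowMap (free (space X)) Arrow.minus_e
      (arrowMap (free (space X)) Arrow.b_minus (gen (space X) b β))) =
      arrowMap (free (relationSpace X)) Arrow.minus_e (relBMinus X β) +
        relMinusE X (arrowMap X Arrow.b_minus β) :=
    (LinearMap.coprod_apply _ _ ((β, 0), (0, 0), 0)).trans (by simp)
  have r6 (β : space X b) : retraction X e (arrowMap (free (space X)) Arrow.plus_e
      (arrowMap (free (space X)) Arrow.b_plus (gen (space X) b β))) =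
      arrowMap (free (relationSpace X)) Arrow.plus_e (relBPlus X β) +
        relPlusE X (arrowMap X Arrow.b_plus β) :=
    (LinearMap.coprod_apply _ _ ((0, β), (0, 0), 0)).trans (by simp)
  have r7 (μ : space X minus) : retraction X e (arrowMap (free (space X)) Arrow.minus_e
      (gen (space X) minus μ)) = relMinusE X μ :=
    (LinearMap.coprod_apply _ _ ((0, 0), (μ, 0), 0)).trans (by simp)
  have r8 (ρ : space X plus) : retraction X e (arrowMap (free (space X)) Arrow.plus_e
      (gen (space X) plus ρ)) = relPlusE X ρ :=
    (LinearMap.coprod_apply _ _ ((0, 0), (0, ρ), 0)).trans (by simp)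
  have r9 (ε : space X e) : retraction X e (gen (space X) e ε) = 0 :=
    (LinearMap.coprod_apply _ _ ((0, 0), (0, 0), ε)).trans (by simp)
  have cg (v : Q2) (x : space X v) :
      component (freeLift (Y := X) fun _ => LinearMap.id) v (gen (space X) v x) = x :=
    component_freeLift_gen _ v x
  refine shortExact_of_split _ (retraction X) (gen (space X)) ?_ cg ?_
  · change ∀ v x, retraction X v (component (relationHom X) v x) = x
    intro v x
    cases v
    · exact Subsingleton.elim (α := PUnit) _ _
    · obtain ⟨β, rfl⟩ := exists_eq_relBMinus x
      simp only [relationHom_relBMinus, arrowRelation_apply, map_sub, r1, r2, sub_zero]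
    · obtain ⟨β, rfl⟩ := exists_eq_relBPlus x
      simp only [relationHom_relBPlus, arrowRelation_apply, map_sub, r3, r4, sub_zero]
    · obtain ⟨β₁, β₂, μ, ρ, rfl⟩ := exists_eq_relE x
      simp only [map_add, component_arrowMap, relationHom_relBMinus, relationHom_relBPlus,
        relationHom_relMinusE, relationHom_relPlusE, arrowRelation_apply, map_sub, r5, r6, r7, r8,
        r9, sub_zero, add_sub_cancel_right]
  · change ∀ v x, component (relationHom X) v (retraction X v x) +
      gen (space X) v (component (freeLift (Y := X) fun _ => LinearMap.id) v x) = x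
    intro v x
    cases v
    · rw [free_relation_b (retraction X b x), map_zero, zero_add]
      rfl
    · obtain ⟨β, μ, rfl⟩ := exists_eq_gen_minus x
      simp only [map_add, component_arrowMap, cg, r1, r2, relationHom_relBMinus,
        arrowRelation_apply, add_zero]
      abel
    · obtain ⟨β, μ, rfl⟩ := exists_eq_gen_plus x
      simp only [map_add, component_arrowMap, cg, r3, r4, relationHom_relBPlus,
        arrowRelation_apply, add_zero]
      abel
    · obtain ⟨β₁, β₂, μ, ρ, ε, rfl⟩ := exists_eq_gen_e x
      simp only [map_add, component_arrowMap, cg, r5, r6, r7, r8, r9, relationHom_relBMinus,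
        relationHom_relBPlus, relationHom_relMinusE, relationHom_relPlusE, map_sub,
        arrowRelation_apply, add_zero]
      abel

end StandardResolution
end Q2

/-- For a short exact sequence with projective first two terms, the vanishing of the higher
extension groups of the third term is the surjectivity of a restriction map. -/
lemma CategoryTheory.ShortComplex.ShortExact.ext_eq_zero_iff {C : Type u} [Category.{v} C]
    [Abelian C] [HasExt.{max u v} C] {S : ShortComplex C} (hS : S.ShortExact) [Projective S.X₁]
    [Projective S.X₂] (Y : C) :
    (∀ n : ℕ, 1 ≤ n → ∀ x : Abelian.Ext.{max u v} S.X₃ Y n, x = 0) ↔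
      ∀ y : S.X₁ ⟶ Y, ∃ z : S.X₂ ⟶ Y, S.f ≫ z = y := by
  have p (P : C) [Projective P] {n : ℕ} (hn : 1 ≤ n) (x : Abelian.Ext.{max u v} P Y n) : x = 0 :=
    Abelian.Ext.eq_zero_of_hasProjectiveDimensionLT x 1 hn
  refine ⟨fun h y => ?_, fun h n hn x => ?_⟩
  · obtain ⟨z, hz⟩ := Abelian.Ext.contravariant_sequence_exact₁ hS Y (Abelian.Ext.mk₀ y)
      (n₁ := 1) rfl (h 1 le_rfl _)
    obtain ⟨z, rfl⟩ := (Abelian.Ext.mk₀_bijective _ _).2 z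
    rw [Abelian.Ext.mk₀_comp_mk₀] at hz
    exact ⟨z, (Abelian.Ext.mk₀_bijective _ _).1 hz⟩
  · obtain ⟨m, rfl⟩ := Nat.exists_eq_add_of_le hn
    -- Here `n = 1 + m`. Since `Ext^n(S.X₂, Y) = 0`, the class `x` is the extension class composed
    -- with some `y` of degree `m` on `S.X₁`. For `m = 0` this `y` factors through `S.f`, which the
    -- extension class annihilates; for `m > 0` it is zero by projectivity.
    obtain ⟨y, rfl⟩ := Abelian.Ext.contravariant_sequence_exact₃ hS Y x (p _ hn _) (n₀ := m) rfl
    rcases Nat.eq_zero_or_pos m with rfl | hm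
    · obtain ⟨y, rfl⟩ := (Abelian.Ext.mk₀_bijective _ _).2 y
      obtain ⟨z, rfl⟩ := h y
      rw [← Abelian.Ext.mk₀_comp_mk₀, hS.extClass_comp_assoc]
    · rw [p _ hm y, Abelian.Ext.comp_zero]

namespace Q2

/-! ### Rigidity and the Tits form -/

section Rigid

variable {k : Type u} [Field k]

/-- A representation is rigid if every family of linear maps along the arrows is the commutator
of the arrows with a family of linear maps at the vertices. -/
def Rigid (X : QuiverRep k Q2) : Prop :=
  ∀ (φ₁ : space X b →ₗ[k] space X minus) (φ₂ : space X b →ₗ[k] space X plus)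
    (φ₃ : space X minus →ₗ[k] space X e) (φ₄ : space X plus →ₗ[k] space X e),
    ∃ g : ∀ v : Q2, space X v →ₗ[k] space X v,
      (∀ x, arrowMap X Arrow.b_minus (g b x) - g minus (arrowMap X Arrow.b_minus x) = φ₁ x) ∧
      (∀ x, arrowMap X Arrow.b_plus (g b x) - g plus (arrowMap X Arrow.b_plus x) = φ₂ x) ∧
      (∀ x, arrowMap X Arrow.minus_e (g minus x) - g e (arrowMap X Arrow.minus_e x) = φ₃ x) ∧
      (∀ x, arrowMap X Arrow.plus_e (g plus x) - g e (arrowMap X Arrow.plus_e x) = φ₄ x)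

/-- The values on the relations given by linear maps along the arrows. -/
noncomputable def relationValue {X Y : QuiverRep k Q2} (φ₁ : space X b →ₗ[k] space Y minus)
    (φ₂ : space X b →ₗ[k] space Y plus) (φ₃ : space X minus →ₗ[k] space Y e)
    (φ₄ : space X plus →ₗ[k] space Y e) : ∀ v, relationSpace X v →ₗ[k] space Y v
  | b => 0
  | minus => φ₁
  | plus => φ₂
  | e => φ₃.coprod φ₄

/-- Morphisms out of the two free terms are families of linear maps, indexed by arrows for the
relations and by vertices for the generators. Restriction along `relationHom` becomes the
commutator. -/
lemma rigid_iff (X : QuiverRep k Q2) :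
    Rigid X ↔ ∀ y : (resolution X).X₁ ⟶ X, ∃ z : (resolution X).X₂ ⟶ X,
      (resolution X).f ≫ z = y := by
  change _ ↔ ∀ y : free (relationSpace X) ⟶ X, ∃ z : free (space X) ⟶ X, relationHom X ≫ z = y
  constructor
  · intro h y
    obtain ⟨g, h₁, h₂, h₃, h₄⟩ := h (component y minus ∘ₗ relBMinus X)
      (component y plus ∘ₗ relBPlus X) (component y e ∘ₗ relMinusE X)
      (component y e ∘ₗ relPlusE X)
    refine ⟨freeLift g, ?_⟩
    apply relation_hom_ext <;> intro x <;>
      simp only [component_comp, relationHom_relBMinus, relationHom_relBPlus,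
        relationHom_relMinusE, relationHom_relPlusE, arrowRelation_apply, map_sub,
        component_arrowMap, component_freeLift_gen, h₁, h₂, h₃, h₄, LinearMap.comp_apply]
  · intro h φ₁ φ₂ φ₃ φ₄
    obtain ⟨z, hz⟩ := h (freeLift (relationValue φ₁ φ₂ φ₃ φ₄))
    have key {v w : Q2} (a : v ⟶ w) (x : space X v) : component z w (arrowRelation X a x) =
        arrowMap X a (component z v (gen (space X) v x)) -
          component z w (gen (space X) w (arrowMap X a x)) := by
      rw [arrowRelation_apply, map_sub, component_arrowMap]
    refine ⟨fun v => component z v ∘ₗ gen (space X) v, fun x => ?_, fun x => ?_, fun x => ?_,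
      fun x => ?_⟩
    · refine (key _ x).symm.trans ?_
      rw [← relationHom_relBMinus, ← component_comp, hz, freeLift_relBMinus]
      rfl
    · refine (key _ x).symm.trans ?_
      rw [← relationHom_relBPlus, ← component_comp, hz, freeLift_relBPlus]
      rfl
    · refine (key _ x).symm.trans ?_
      rw [← relationHom_relMinusE, ← component_comp, hz, freeLift_relMinusE]
      exact (LinearMap.coprod_apply φ₃ φ₄ (x, 0)).trans (by simp)
    · refine (key _ x).symm.trans ?_
      rw [← relationHom_relPlusE, ← component_comp, hz, freeLift_relPlusE]
      exact (LinearMap.coprod_apply φ₃ φ₄ (0, x)).trans (by simp)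

lemma isExceptional_iff_rigid (X : QuiverRep k Q2) :
    IsExceptional k X ↔ Module.finrank k (X ⟶ X) = 1 ∧ Rigid X := by
  have : HasExt.{u + 1} (QuiverRep k Q2) := HasExt.standard _
  have : Projective (resolution X).X₁ := inferInstanceAs (Projective (free _))
  have : Projective (resolution X).X₂ := inferInstanceAs (Projective (free _))
  rw [rigid_iff, ← (resolution_shortExact X).ext_eq_zero_iff X]
  exact ⟨fun h => ⟨h.1, h.2⟩, fun h => ⟨h.1, h.2⟩⟩

/-- The dimension of a representation at a vertex. -/
noncomputable def dim (X : QuiverRep k Q2) (v : Q2) : ℕ := Module.finrank k (space X v)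

variable (X : QuiverRep k Q2)

/-- The commutator of the arrows with a family of linear maps at the vertices. -/
noncomputable def commutator :
    ((space X b →ₗ[k] space X b) × (space X minus →ₗ[k] space X minus) ×
      (space X plus →ₗ[k] space X plus) × (space X e →ₗ[k] space X e)) →ₗ[k]
    ((space X b →ₗ[k] space X minus) × (space X b →ₗ[k] space X plus) ×
      (space X minus →ₗ[k] space X e) × (space X plus →ₗ[k] space X e)) where
  toFun g :=
    (arrowMap X Arrow.b_minus ∘ₗ g.1 - g.2.1 ∘ₗ arrowMap X Arrow.b_minus,
      arrowMap X Arrow.b_plus ∘ₗ g.1 - g.2.2.1 ∘ₗ arrowMap X Arrow.b_plus,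
      arrowMap X Arrow.minus_e ∘ₗ g.2.1 - g.2.2.2 ∘ₗ arrowMap X Arrow.minus_e,
      arrowMap X Arrow.plus_e ∘ₗ g.2.2.1 - g.2.2.2 ∘ₗ arrowMap X Arrow.plus_e)
  map_add' g h := by
    ext <;> simp <;> abel
  map_smul' c g := by
    ext <;> simp [smul_sub]

/-- A family of linear maps at the vertices. -/
def family (g : (space X b →ₗ[k] space X b) × (space X minus →ₗ[k] space X minus) ×
      (space X plus →ₗ[k] space X plus) × (space X e →ₗ[k] space X e)) :
    ∀ v : Q2, space X v →ₗ[k] space X v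
  | b => g.1
  | minus => g.2.1
  | plus => g.2.2.1
  | e => g.2.2.2

/-- The endomorphisms of a representation are the kernel of the commutator map. -/
noncomputable def endEquiv : (X ⟶ X) ≃ₗ[k] LinearMap.ker (commutator X) where
  toFun f := ⟨(component f b, component f minus, component f plus, component f e), by
    simp only [commutator, LinearMap.mem_ker, LinearMap.coe_mk, AddHom.coe_mk, Prod.mk_eq_zero,
      LinearMap.ext_iff, LinearMap.sub_apply, LinearMap.comp_apply, component_arrowMap, sub_self,
      LinearMap.zero_apply, implies_true, and_self]⟩
  map_add' f g := rfl
  map_smul' c f := rfl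
  invFun g := homMk (family X g.1) (by
    obtain ⟨g, hg⟩ := g
    simp only [commutator, LinearMap.mem_ker, LinearMap.coe_mk, AddHom.coe_mk, Prod.mk_eq_zero,
      LinearMap.ext_iff, LinearMap.comp_apply, sub_eq_zero] at hg
    exact arrow_cases (fun x => (hg.1 x).symm) (fun x => (hg.2.1 x).symm)
      (fun x => (hg.2.2.1 x).symm) (fun x => (hg.2.2.2 x).symm))
  left_inv f := hom_ext fun v x => by cases v <;> rfl
  right_inv g := rfl

lemma rigid_iff_surjective : Rigid X ↔ Function.Surjective (commutator X) := by
  constructor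
  · rintro h ⟨φ₁, φ₂, φ₃, φ₄⟩
    obtain ⟨g, h₁, h₂, h₃, h₄⟩ := h φ₁ φ₂ φ₃ φ₄
    refine ⟨(g b, g minus, g plus, g e), ?_⟩
    ext x
    exacts [h₁ x, h₂ x, h₃ x, h₄ x]
  · intro h φ₁ φ₂ φ₃ φ₄
    obtain ⟨g, hg⟩ := h (φ₁, φ₂, φ₃, φ₄)
    simp only [commutator, LinearMap.coe_mk, AddHom.coe_mk, Prod.mk.injEq, LinearMap.ext_iff,
      LinearMap.sub_apply, LinearMap.comp_apply] at hg
    exact ⟨family X g, hg⟩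

/-- A representation is exceptional if and only if its endomorphisms are scalar and its dimension
vector is a root of the Tits form. -/
lemma isExceptional_iff : IsExceptional k X ↔ Module.finrank k (X ⟶ X) = 1 ∧
    dim X b ^ 2 + dim X minus ^ 2 + dim X plus ^ 2 + dim X e ^ 2 =
      1 + dim X b * dim X minus + dim X b * dim X plus + dim X minus * dim X e +
        dim X plus * dim X e := by
  rw [isExceptional_iff_rigid, rigid_iff_surjective]
  refine and_congr_right fun h => ?_
  rw [← LinearMap.range_eq_top]
  -- The kernel has dimension 1, so the range fills the target exactly when the source has dimension
  -- one more than the target. This is the displayed equation.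
  have h₁ := LinearMap.finrank_range_add_finrank_ker (commutator X)
  rw [← (endEquiv X).finrank_eq, h] at h₁
  have h₂ := Submodule.finrank_le (LinearMap.range (commutator X))
  have h₃ : LinearMap.range (commutator X) = ⊤ ↔ _ :=
    ⟨fun h => by rw [h, finrank_top], Submodule.eq_top_of_finrank_eq⟩
  rw [h₃]
  simp only [Module.finrank_prod, Module.finrank_linearMap] at h₁ ⊢
  unfold dim
  constructor <;> intro h' <;> nlinarith

end Rigid
-- Pencils of linear maps and their normal form
section Pencil

variable {k : Type u} [Field k]

/-- All nonzero combinations of `A` and `B` are surjective. -/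
def SurjectivePencil {V W : Type*} [AddCommGroup V] [Module k V] [AddCommGroup W] [Module k W]
    (A B : V →ₗ[k] W) : Prop :=
  ∀ s t : k, s ≠ 0 ∨ t ≠ 0 → Function.Surjective (s • A + t • B)

/-- Every nonzero combination has a one-dimensional kernel, so a common zero `x ≠ 0` of `A` and `B`
would span each of these kernels. For a section `s` of `A` and an eigenvector `w` of `B ∘ₗ s` with
eigenvalue `μ`, the combination `B - μA` kills `s w`. But `A (s w) = w ≠ 0`, so `s w` is not a
multiple of `x`. -/
lemma SurjectivePencil.injective [IsAlgClosed k] {V W : Type*} [AddCommGroup V] [Module k V]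
    [AddCommGroup W] [Module k W] [Module.Finite k V] [Module.Finite k W] {A B : V →ₗ[k] W}
    (h : SurjectivePencil A B) (hd : Module.finrank k V = Module.finrank k W + 1)
    (hW : 0 < Module.finrank k W) : Function.Injective (A.prod B) := by
  have : Nontrivial W := Module.finrank_pos_iff.1 hW
  rw [injective_iff_map_eq_zero]
  intro x hx
  have hA : A x = 0 := congrArg Prod.fst hx
  have hB : B x = 0 := congrArg Prod.snd hx
  obtain ⟨s, hs⟩ := A.exists_rightInverse_of_surjective
    (LinearMap.range_eq_top.2 (by simpa using h 1 0 (by simp)))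
  obtain ⟨μ, hμ⟩ := Module.End.exists_eigenvalue (B ∘ₗ s)
  obtain ⟨w, hw, hw0⟩ := hμ.exists_hasEigenvector
  rw [Module.End.mem_eigenspace_iff, LinearMap.comp_apply] at hw
  have hsw : A (s w) = w := LinearMap.congr_fun hs w
  set C : V →ₗ[k] W := (-μ) • A + (1 : k) • B
  have hC : Module.finrank k (LinearMap.ker C) = 1 := by
    have := LinearMap.finrank_range_add_finrank_ker C
    rw [LinearMap.range_eq_top.2 (h _ _ (by simp)), finrank_top] at this
    omega
  by_contra hx0
  have hx' : x ∈ LinearMap.ker C := by simp [C, hA, hB]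
  have hy' : s w ∈ LinearMap.ker C := by simp [C, hsw, hw]
  obtain ⟨c, hc⟩ := (finrank_eq_one_iff_of_nonzero' (⟨x, hx'⟩ : LinearMap.ker C)
    (by simpa [Subtype.ext_iff] using hx0)).1 hC ⟨s w, hy'⟩
  have hc' : c • x = s w := congrArg Subtype.val hc
  apply hw0
  rw [← hsw, ← hc', map_smul, hA, smul_zero]

/-- The reflection of a surjective pencil is a surjective pencil. -/
lemma SurjectivePencil.reflection {V W : Type*} [AddCommGroup V] [Module k V] [AddCommGroup W]
    [Module k W] {A B : V →ₗ[k] W} (h : SurjectivePencil A B) :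
    SurjectivePencil ((LinearMap.range (A.prod B)).mkQ ∘ₗ LinearMap.inr k W W)
      (-((LinearMap.range (A.prod B)).mkQ ∘ₗ LinearMap.inl k W W)) := by
  intro s t hst c
  obtain ⟨⟨x, y⟩, rfl⟩ := Submodule.mkQ_surjective _ c
  -- A preimage `w` of the class of `(x, y)` must satisfy `(x, y) = (A v - t w, B v + s w)` for some
  -- `v`. Eliminating `w` leaves `s A v + t B v = s x + t y`, which surjectivity solves.
  obtain ⟨v, hv⟩ := h s t hst (s • x + t • y)
  simp only [LinearMap.add_apply, LinearMap.smul_apply] at hv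
  suffices ∃ w, x = A v - t • w ∧ y = B v + s • w by
    obtain ⟨w, rfl, rfl⟩ := this
    refine ⟨w, ?_⟩
    simp only [LinearMap.add_apply, LinearMap.smul_apply, LinearMap.comp_apply,
      LinearMap.neg_apply, ← map_smul, ← map_neg, ← map_add]
    rw [← sub_eq_zero, ← map_sub, Submodule.mkQ_apply, Submodule.Quotient.mk_eq_zero]
    refine ⟨-v, ?_⟩
    simp
    abel
  rcases eq_or_ne s 0 with rfl | hs
  · have ht : t ≠ 0 := by simpa using hst
    refine ⟨t⁻¹ • (A v - x), ?_, ?_⟩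
    · simp [smul_smul, ht]
    · simpa [ht] using hv.symm
  · refine ⟨s⁻¹ • (y - B v), ?_, by simp [smul_smul, hs]⟩
    have : s • (x - (A v - t • s⁻¹ • (y - B v))) = 0 := by
      have e : s • t • s⁻¹ • (y - B v) = t • (y - B v) := by
        simp only [smul_smul]
        congr 1
        field_simp
      rw [smul_sub, smul_sub, e, smul_sub, sub_eq_zero]
      rw [eq_sub_of_add_eq hv.symm]
      abel
    exact sub_eq_zero.1 ((smul_eq_zero.1 this).resolve_left hs)

/-- Induction by reflection: `V` embeds in `W × W`, and the pair `W`, `(W × W) / V` carries a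
surjective pencil with both dimensions one smaller. The relations of its chain `w` say exactly that
`(0, w₀)`, `(wᵢ, wᵢ₊₁)` and `(wₘ, 0)` lie in the image of `V`. Their preimages form the chain in
`V`. -/
lemma SurjectivePencil.exists_chain [IsAlgClosed k] (m : ℕ) : ∀ {V W : Type u} [AddCommGroup V]
    [Module k V] [AddCommGroup W] [Module k W] [Module.Finite k V] [Module.Finite k W]
    {A B : V →ₗ[k] W}, SurjectivePencil A B → Module.finrank k V = m + 1 →
    Module.finrank k W = m → ∃ (v : Fin (m + 1) → V) (w : Fin m → W), LinearIndependent k v ∧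
      LinearIndependent k w ∧ A (v 0) = 0 ∧ (∀ i : Fin m, A (v i.succ) = w i) ∧
      (∀ i : Fin m, B (v i.castSucc) = w i) ∧ B (v (Fin.last m)) = 0 := by
  induction m with
  | zero =>
    intro V W _ _ _ _ _ _ A B h hV hW
    have : Nontrivial V := (Module.finrank_pos_iff (R := k)).1 (by omega)
    have : Subsingleton W := (Module.finrank_zero_iff (R := k)).1 hW
    obtain ⟨v, hv⟩ := exists_ne (0 : V)
    exact ⟨fun _ => v, Fin.elim0, (linearIndependent_unique_iff (ι := Fin 1)).2 hv,
      linearIndependent_empty_type, Subsingleton.elim _ _, fun i => i.elim0, fun i => i.elim0,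
      Subsingleton.elim _ _⟩
  | succ m ih =>
    intro V W _ _ _ _ _ _ A B h hV hW
    have hinj := h.injective (by omega) (by omega)
    have hC : Module.finrank k ((W × W) ⧸ LinearMap.range (A.prod B)) = m := by
      have h₁ := Submodule.finrank_quotient_add_finrank (LinearMap.range (A.prod B))
      rw [LinearMap.finrank_range_of_inj hinj, Module.finrank_prod] at h₁
      omega
    obtain ⟨w, c, hw, -, h₁, h₂, h₃, h₄⟩ := ih h.reflection hW hC
    simp only [LinearMap.comp_apply, LinearMap.neg_apply, neg_eq_zero, Submodule.mkQ_apply,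
      Submodule.Quotient.mk_eq_zero, LinearMap.inl_apply, LinearMap.inr_apply] at h₁ h₂ h₃ h₄
    have key : ∀ j : Fin (m + 2), ∃ v, A v = Fin.cons (α := fun _ => W) 0 w j ∧
        B v = Fin.snoc (α := fun _ => W) w 0 j := by
      suffices ∀ j : Fin (m + 2), (Fin.cons (α := fun _ => W) 0 w j,
          Fin.snoc (α := fun _ => W) w 0 j) ∈ LinearMap.range (A.prod B) by
        intro j
        obtain ⟨v, hv⟩ := this j
        exact ⟨v, congrArg Prod.fst hv, congrArg Prod.snd hv⟩
      intro j
      refine Fin.cases ?_ (fun i => ?_) j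
      · rw [Fin.cons_zero, ← Fin.castSucc_zero, Fin.snoc_castSucc]
        exact h₁
      · rw [Fin.cons_succ]
        refine Fin.lastCases ?_ (fun i => ?_) i
        · rw [Fin.succ_last, Fin.snoc_last]
          exact h₄
        · rw [Fin.succ_castSucc, Fin.snoc_castSucc]
          have := (h₂ i).trans (h₃ i).symm
          rw [← sub_eq_zero, sub_neg_eq_add, ← Submodule.Quotient.mk_add,
            Submodule.Quotient.mk_eq_zero] at this
          simpa using this
    choose v hA hB using key
    refine ⟨v, w, ?_, hw, hA 0, fun i => by rw [hA, Fin.cons_succ],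
      fun i => by rw [hB, Fin.snoc_castSucc], by rw [hB, Fin.snoc_last]⟩
    rw [Fintype.linearIndependent_iff] at hw ⊢
    intro a ha
    -- Applying `A` to the dependence removes only the first coefficient, so all the others vanish.
    -- Applying `B`, which removes only the last, disposes of the first.
    have hs : ∀ i : Fin (m + 1), a i.succ = 0 := by
      apply hw fun i => a i.succ
      have := congrArg A ha
      simpa [Fin.sum_univ_succ (n := m + 1), hA] using this
    refine Fin.cases ?_ hs
    apply hw (fun i => a i.castSucc) _ 0
    have := congrArg B ha
    simpa [Fin.sum_univ_castSucc (n := m + 1), hB] using this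

lemma piMinus_single_succ {m : ℕ} (i : Fin m) :
    piMinus k m (Pi.single i.succ 1) = Pi.single i 1 := by
  ext j; simp [piMinus, Pi.single_apply]

lemma piPlus_single_castSucc {m : ℕ} (i : Fin m) :
    piPlus k m (Pi.single i.castSucc 1) = Pi.single i 1 := by
  ext j; simp [piPlus, Pi.single_apply]

lemma piMinus_single_zero {m : ℕ} : piMinus k m (Pi.single 0 1) = 0 := by
  ext j; simp [piMinus]

lemma piPlus_single_last {m : ℕ} : piPlus k m (Pi.single (Fin.last m) 1) = 0 := by
  ext j; simp [piPlus]

/-- The normal form of a surjective pencil. -/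
lemma SurjectivePencil.exists_equiv [IsAlgClosed k] {m : ℕ} {V W : Type u} [AddCommGroup V]
    [Module k V] [AddCommGroup W] [Module k W] [Module.Finite k V] [Module.Finite k W]
    {A B : V →ₗ[k] W} (h : SurjectivePencil A B) (hV : Module.finrank k V = m + 1)
    (hW : Module.finrank k W = m) :
    ∃ (eV : V ≃ₗ[k] (Fin (m + 1) → k)) (eW : W ≃ₗ[k] (Fin m → k)), ∀ x,
      eW (A x) = piMinus k m (eV x) ∧ eW (B x) = piPlus k m (eV x) := by
  obtain ⟨v, w, hv, hw, h₁, h₂, h₃, h₄⟩ := h.exists_chain m hV hW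
  let bv := Module.Basis.mk hv (hv.span_eq_top_of_card_eq_finrank' (by simp [hV])).ge
  let bw := Module.Basis.mk hw (hw.span_eq_top_of_card_eq_finrank' (by simp [hW])).ge
  have hbv (i) : bv i = v i := Module.Basis.mk_apply _ _ i
  have hbw (i) : bw i = w i := Module.Basis.mk_apply _ _ i
  have ev (i) : bv.equivFun (v i) = Pi.single i 1 := by
    rw [← hbv]; ext j; simp [Pi.single_apply, eq_comm]
  have ew (i) : bw.equivFun (w i) = Pi.single i 1 := by
    rw [← hbw]; ext j; simp [Pi.single_apply, eq_comm]
  have hA : bw.equivFun.toLinearMap ∘ₗ A = piMinus k m ∘ₗ bv.equivFun.toLinearMap := by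
    refine bv.ext fun i => ?_
    simp only [LinearMap.comp_apply, LinearEquiv.coe_coe, hbv, ev]
    refine Fin.cases ?_ (fun i => ?_) i
    · rw [h₁, map_zero, piMinus_single_zero]
    · rw [h₂, ew, piMinus_single_succ]
  have hB : bw.equivFun.toLinearMap ∘ₗ B = piPlus k m ∘ₗ bv.equivFun.toLinearMap := by
    refine bv.ext fun i => ?_
    simp only [LinearMap.comp_apply, LinearEquiv.coe_coe, hbv, ev]
    refine Fin.lastCases ?_ (fun i => ?_) i
    · rw [h₄, map_zero, piPlus_single_last]
    · rw [h₃, ew, piPlus_single_castSucc]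
  exact ⟨bv.equivFun, bw.equivFun, fun x => ⟨LinearMap.congr_fun hA x, LinearMap.congr_fun hB x⟩⟩

/-- The normal form of a pencil of injective maps. -/
lemma exists_equiv_of_injective [IsAlgClosed k] {m : ℕ} {V W : Type u} [AddCommGroup V]
    [Module k V] [AddCommGroup W] [Module k W] [Module.Finite k V] [Module.Finite k W]
    {A B : V →ₗ[k] W} (h : ∀ s t : k, s ≠ 0 ∨ t ≠ 0 → Function.Injective (s • A + t • B))
    (hV : Module.finrank k V = m) (hW : Module.finrank k W = m + 1) :
    ∃ (eV : V ≃ₗ[k] (Fin m → k)) (eW : W ≃ₗ[k] (Fin (m + 1) → k)), ∀ x,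
      eW (A x) = jMinus k m (eV x) ∧ eW (B x) = jPlus k m (eV x) := by
  have hd : SurjectivePencil A.dualMap B.dualMap := fun s t hst => by
    have := LinearMap.dualMap_surjective_iff.2 (h s t hst)
    have e : (s • A + t • B).dualMap = s • A.dualMap + t • B.dualMap := by
      ext f x; simp
    rwa [e] at this
  -- The chain for the dual pencil supplies coordinate functionals: `η` on `W` and `ξ` on `V`. The
  -- relations `η₀ ∘ A = 0` and `ηᵢ₊₁ ∘ A = ξᵢ` say that `A` prepends a zero; those for `B` say that
  -- it appends one.
  obtain ⟨η, ξ, hη, hξ, h₁, h₂, h₃, h₄⟩ := hd.exists_chain m (by simp [hW]) (by simp [hV])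
  have bij {n : ℕ} {U : Type u} [AddCommGroup U] [Module k U] [Module.Finite k U]
      {ζ : Fin n → Module.Dual k U} (hζ : LinearIndependent k ζ) (hU : Module.finrank k U = n) :
      Function.Bijective (LinearMap.pi ζ) := by
    have hinj : Function.Injective (LinearMap.pi ζ) := by
      rw [injective_iff_map_eq_zero]
      intro x hx
      rw [← Module.forall_dual_apply_eq_zero_iff k]
      have hspan := hζ.span_eq_top_of_card_eq_finrank' (by simp [hU])
      intro f
      have hf : f ∈ Submodule.span k (Set.range ζ) := hspan ▸ Submodule.mem_top
      induction hf using Submodule.span_induction with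
      | mem f hf =>
        obtain ⟨i, rfl⟩ := hf
        exact congrFun hx i
      | zero => rfl
      | add f g _ _ hf hg => simp [hf, hg]
      | smul c f _ hf => simp [hf]
    exact ⟨hinj, (LinearMap.injective_iff_surjective_of_finrank_eq_finrank (by simp [hU])).1 hinj⟩
  refine ⟨LinearEquiv.ofBijective _ (bij hξ hV), LinearEquiv.ofBijective _ (bij hη hW),
    fun x => ⟨?_, ?_⟩⟩
  · ext i
    refine Fin.cases ?_ (fun i => ?_) i
    · exact LinearMap.congr_fun h₁ x
    · exact LinearMap.congr_fun (h₂ i) x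
  · ext i
    refine Fin.lastCases ?_ (fun i => ?_) i
    · simpa [jPlus] using LinearMap.congr_fun h₄ x
    · simpa [jPlus] using LinearMap.congr_fun (h₃ i) x

/-- The matrix is constant along diagonals, and every diagonal except the main one meets the first
column below its top entry or the last column above its bottom entry, where the entries are zero. -/
lemma toeplitz {m : ℕ} {M : Fin (m + 1) → Fin (m + 1) → k}
    (h : ∀ a b : Fin m, M a.succ b.succ = M a.castSucc b.castSucc)
    (h₀ : ∀ a : Fin m, M a.succ 0 = 0) (h₁ : ∀ a : Fin m, M a.castSucc (Fin.last m) = 0)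
    (a b : Fin (m + 1)) : M a b = if a = b then M 0 0 else 0 := by
  have lower (b : Fin (m + 1)) : ∀ a, b < a → M a b = 0 := by
    induction b using Fin.induction with
    | zero =>
      intro a ha
      obtain ⟨a, rfl⟩ := Fin.exists_succ_eq.2 ha.ne'
      exact h₀ a
    | succ b ih =>
      intro a ha
      obtain ⟨a, rfl⟩ := Fin.exists_succ_eq.2 (Fin.ne_zero_of_lt ha)
      rw [h]
      exact ih _ (by simpa using ha)
  have upper (b : Fin (m + 1)) : ∀ a, a < b → M a b = 0 := by
    induction b using Fin.reverseInduction with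
    | last =>
      intro a ha
      obtain ⟨a, rfl⟩ := Fin.exists_castSucc_eq.2 ha.ne
      exact h₁ a
    | cast b ih =>
      intro a ha
      obtain ⟨a, rfl⟩ := Fin.exists_castSucc_eq.2 (Fin.ne_last_of_lt ha)
      rw [← h]
      exact ih _ (by simpa using ha)
  have diag (b : Fin (m + 1)) : M b b = M 0 0 := by
    induction b using Fin.induction with
    | zero => rfl
    | succ b ih => rw [h, ih]
  rcases lt_trichotomy a b with hab | rfl | hab
  · rw [upper b a hab, if_neg hab.ne]
  · rw [if_pos rfl, diag]
  · rw [lower b a hab, if_neg hab.ne']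

/-- The matrix of `g` is Toeplitz because `π₋` and `π₊` send consecutive basis vectors to the same
vector. The kernels of `π₋` and `π₊`, spanned by the first and last basis vectors, supply the
boundary zeros. Surjectivity of `π₊` carries the scalar over to `h`. -/
lemma pi_end_scalar {m : ℕ} (g : (Fin (m + 1) → k) →ₗ[k] (Fin (m + 1) → k))
    (h : (Fin m → k) →ₗ[k] (Fin m → k)) (h₁ : ∀ x, h (piMinus k m x) = piMinus k m (g x))
    (h₂ : ∀ x, h (piPlus k m x) = piPlus k m (g x)) :
    ∃ c : k, (∀ x, g x = c • x) ∧ ∀ x, h x = c • x := by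
  have key := toeplitz (M := fun a b => g (Pi.single b 1) a)
    (fun a b => by
      have := congrFun ((h₁ (Pi.single b.succ 1)).symm.trans
        ((congrArg h ((piMinus_single_succ b).trans (piPlus_single_castSucc b).symm)).trans (h₂ _))) a
      exact this)
    (fun a => (congrFun (h₁ (Pi.single 0 1)).symm a).trans (by simp [piMinus_single_zero]))
    (fun a => (congrFun (h₂ (Pi.single (Fin.last m) 1)).symm a).trans
      (by simp [piPlus_single_last]))
  have hg : g = g (Pi.single 0 1) 0 • LinearMap.id := by
    refine LinearMap.pi_ext' fun b => LinearMap.ext_ring ?_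
    ext a
    simpa [Pi.single_apply] using key a b
  have hg' (x) : g x = g (Pi.single 0 1) 0 • x := LinearMap.congr_fun hg x
  refine ⟨g (Pi.single 0 1) 0, hg', fun x => ?_⟩
  have : piPlus k m (Fin.snoc (α := fun _ => k) x 0) = x := by
    ext i; simp [piPlus]
  rw [← this, h₂, hg', map_smul]

lemma j_end_scalar {m : ℕ} (g : (Fin m → k) →ₗ[k] (Fin m → k))
    (h : (Fin (m + 1) → k) →ₗ[k] (Fin (m + 1) → k)) (h₁ : ∀ x, h (jMinus k m x) = jMinus k m (g x))
    (h₂ : ∀ x, h (jPlus k m x) = jPlus k m (g x)) :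
    ∃ c : k, (∀ x, g x = c • x) ∧ ∀ x, h x = c • x := by
  have e₁ (b : Fin m) : jMinus k m (Pi.single b 1) = Pi.single b.succ 1 := by
    ext i; refine Fin.cases ?_ (fun i => ?_) i <;> simp [jMinus, Pi.single_apply]
  have e₂ (b : Fin m) : jPlus k m (Pi.single b 1) = Pi.single b.castSucc 1 := by
    ext i; refine Fin.lastCases ?_ (fun i => ?_) i <;> simp [jPlus, Pi.single_apply]
  -- The matrix is transposed here, its first index being the input: the boundary zeros now come
  -- from the coordinates missed by the images of `j₋` and `j₊`.
  have key := toeplitz (M := fun b a => h (Pi.single b 1) a)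
    (fun b a => by
      rw [← e₁, ← e₂, h₁, h₂]
      simp [jMinus, jPlus])
    (fun b => by rw [← e₁, h₁]; simp [jMinus])
    (fun b => by rw [← e₂, h₂]; simp [jPlus])
  have hh : h = h (Pi.single 0 1) 0 • LinearMap.id := by
    refine LinearMap.pi_ext' fun b => LinearMap.ext_ring ?_
    ext a
    simpa [Pi.single_apply, eq_comm] using key b a
  have hh' (x) : h x = h (Pi.single 0 1) 0 • x := LinearMap.congr_fun hh x
  refine ⟨h (Pi.single 0 1) 0, fun x => ?_, hh'⟩
  have hj : Function.Injective (jMinus k m) := fun x y hxy => by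
    ext i; simpa [jMinus] using congrFun hxy i.succ
  apply hj
  rw [← h₁, hh', map_smul]

end Pencil
-- Maximal rank, and squares with an invertible path
section LinearAlgebra

variable {k : Type u} [Field k]

/-- A linear map all of whose deformations are trivial has maximal rank. -/
lemma injective_or_surjective {V W : Type*} [AddCommGroup V] [Module k V] [AddCommGroup W]
    [Module k W] (f : V →ₗ[k] W)
    (H : ∀ ψ : V →ₗ[k] W, ∃ (g : V →ₗ[k] V) (h : W →ₗ[k] W), ∀ x, f (g x) - h (f x) = ψ x) :
    Function.Injective f ∨ Function.Surjective f := by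
  by_contra! hf
  obtain ⟨hi, hs⟩ := hf
  rw [injective_iff_map_eq_zero] at hi
  push Not at hi
  obtain ⟨x, hx, hx0⟩ := hi
  apply hs
  intro y
  obtain ⟨φ, hφ⟩ : ∃ φ : Module.Dual k V, φ x ≠ 0 := by
    by_contra! h
    exact hx0 ((Module.forall_dual_apply_eq_zero_iff k x).1 h)
  -- This rank-one deformation sends the kernel vector `x` to `y`. Evaluated at `x`, the term `h (f
  -- x)` drops out and `f (g x) = y` remains.
  obtain ⟨g, h, hgh⟩ := H (((φ x)⁻¹ • φ).smulRight y)
  refine ⟨g x, ?_⟩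
  simpa [hx, hφ] using hgh x

section
variable {V W : Type*} [AddCommGroup V] [Module k V] [AddCommGroup W] [Module k W]
  [Module.Finite k V] [Module.Finite k W] {f : V →ₗ[k] W}
  (h : Function.Injective f ∨ Function.Surjective f)
include h

lemma injective_of_le (hd : Module.finrank k V ≤ Module.finrank k W) : Function.Injective f := by
  refine h.elim id fun hs => ?_
  have := LinearMap.finrank_le_finrank_of_surjective hs
  exact (LinearMap.injective_iff_surjective_of_finrank_eq_finrank (by omega)).2 hs

lemma surjective_of_le (hd : Module.finrank k W ≤ Module.finrank k V) : Function.Surjective f := by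
  refine h.elim (fun hi => ?_) id
  have := LinearMap.finrank_le_finrank_of_injective hi
  exact (LinearMap.injective_iff_surjective_of_finrank_eq_finrank (by omega)).1 hi

end

/-- Matching the middle terms of two factorizations. -/
lemma exists_middle_equiv {V M W V' M' W' : Type*} [AddCommGroup V] [Module k V] [AddCommGroup M]
    [Module k M] [AddCommGroup W] [Module k W] [AddCommGroup V'] [Module k V'] [AddCommGroup M']
    [Module k M'] [AddCommGroup W'] [Module k W'] {f : V →ₗ[k] M} {g : M →ₗ[k] W}
    {f' : V' →ₗ[k] M'} {g' : M' →ₗ[k] W'} (eV : V ≃ₗ[k] V') (eW : W ≃ₗ[k] W')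
    (he : ∀ x, eW (g (f x)) = g' (f' (eV x)))
    (h : (Function.Bijective f ∧ Function.Bijective f') ∨
      (Function.Bijective g ∧ Function.Bijective g')) :
    ∃ eM : M ≃ₗ[k] M', (∀ x, eM (f x) = f' (eV x)) ∧ ∀ y, eW (g y) = g' (eM y) := by
  rcases h with ⟨hf, hf'⟩ | ⟨hg, hg'⟩
  · have key (x) : ((LinearEquiv.ofBijective f hf).symm ≪≫ₗ eV ≪≫ₗ LinearEquiv.ofBijective f' hf')
        (f x) = f' (eV x) := by
      have : (LinearEquiv.ofBijective f hf).symm (f x) = x :=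
        (LinearEquiv.ofBijective f hf).symm_apply_apply x
      simp [this]
    refine ⟨_, key, fun y => ?_⟩
    obtain ⟨x, rfl⟩ := hf.2 y
    rw [he, key]
  · have key (y) : g' ((LinearEquiv.ofBijective g hg ≪≫ₗ eW ≪≫ₗ
        (LinearEquiv.ofBijective g' hg').symm) y) = eW (g y) :=
      (LinearEquiv.ofBijective g' hg').apply_symm_apply (eW (g y))
    exact ⟨_, fun x => hg'.1 (by rw [key, he]), fun y => (key y).symm⟩

/-- If one path of a square of finite-dimensional spaces consists of isomorphisms and all
endomorphisms are scalar, then the other path cannot pass through a space of a different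
dimension by maps of maximal rank, unless the smaller dimension is zero. -/
lemma middle_degenerate {B M P E : Type*} [AddCommGroup B] [Module k B] [AddCommGroup M]
    [Module k M] [AddCommGroup P] [Module k P] [AddCommGroup E] [Module k E] [Module.Finite k B]
    [Module.Finite k P] [Module.Finite k E]
    {f₁ : B →ₗ[k] M} {f₂ : B →ₗ[k] P} {f₃ : M →ₗ[k] E} {f₄ : P →ₗ[k] E}
    (hs : ∀ (gb : B →ₗ[k] B) (gm : M →ₗ[k] M) (gp : P →ₗ[k] P) (ge : E →ₗ[k] E),
      (∀ x, gm (f₁ x) = f₁ (gb x)) → (∀ x, gp (f₂ x) = f₂ (gb x)) →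
      (∀ x, ge (f₃ x) = f₃ (gm x)) → (∀ x, ge (f₄ x) = f₄ (gp x)) →
      ∃ c : k, (∀ x, gb x = c • x) ∧ ∀ x, gp x = c • x)
    (h₁ : Function.Bijective f₁) (h₃ : Function.Bijective f₃)
    (h₂ : Function.Injective f₂ ∨ Function.Surjective f₂)
    (h₄ : Function.Injective f₄ ∨ Function.Surjective f₄) :
    (Module.finrank k P = Module.finrank k B + 1 → Module.finrank k B = 0) ∧
      (Module.finrank k B = Module.finrank k P + 1 → Module.finrank k P = 0) := by
  let e₁ := LinearEquiv.ofBijective f₁ h₁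
  let e₃ := LinearEquiv.ofBijective f₃ h₃
  have hBE := (e₁ ≪≫ₗ e₃).finrank_eq
  have a₁ (x) : e₁.symm (f₁ x) = x := e₁.symm_apply_apply x
  have a₂ (x) : f₁ (e₁.symm x) = x := e₁.apply_symm_apply x
  have a₃ (x) : e₃.symm (f₃ x) = x := e₃.symm_apply_apply x
  have a₄ (x) : f₃ (e₃.symm x) = x := e₃.apply_symm_apply x
  -- The endomorphism that goes once round the square from each vertex, with `f₁` and `f₃` inverted.
  obtain ⟨c, hb, hp⟩ := hs (e₁.symm.toLinearMap ∘ₗ e₃.symm.toLinearMap ∘ₗ f₄ ∘ₗ f₂)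
    (e₃.symm.toLinearMap ∘ₗ f₄ ∘ₗ f₂ ∘ₗ e₁.symm.toLinearMap)
    (f₂ ∘ₗ e₁.symm.toLinearMap ∘ₗ e₃.symm.toLinearMap ∘ₗ f₄)
    (f₄ ∘ₗ f₂ ∘ₗ e₁.symm.toLinearMap ∘ₗ e₃.symm.toLinearMap)
    (by simp [a₁, a₂]) (by simp) (by simp [a₃, a₄]) (by simp)
  simp only [LinearMap.comp_apply, LinearEquiv.coe_coe] at hb hp
  constructor <;> intro hd
  · have hc : c = 0 := by
      by_contra hc
      have : Function.Surjective f₂ := fun y =>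
        ⟨c⁻¹ • (e₁.symm (e₃.symm (f₄ y))), by rw [map_smul, hp, smul_smul, inv_mul_cancel₀ hc,
          one_smul]⟩
      have := LinearMap.finrank_le_finrank_of_surjective this
      omega
    -- With `c = 0` the round trip from `P` is zero. As `f₂` is injective and `f₄` maps onto `E`,
    -- this forces `E = 0`. In the other case `f₂` is onto and `f₄` injective, which forces `P = 0`.
    have hi := injective_of_le h₂ (by omega)
    have hsurj := surjective_of_le h₄ (by omega)
    rw [hBE, Module.finrank_zero_iff (R := k)]
    refine subsingleton_of_forall_eq 0 fun y => ?_
    obtain ⟨x, rfl⟩ := hsurj y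
    have := hp x
    rw [hc, zero_smul, map_eq_zero_iff _ hi, map_eq_zero_iff _ e₁.symm.injective,
      map_eq_zero_iff _ e₃.symm.injective] at this
    exact this
  · have hc : c = 0 := by
      by_contra hc
      have : Function.Injective f₂ := by
        rw [injective_iff_map_eq_zero]
        intro x hx
        have := hb x
        rw [hx, map_zero, map_zero, map_zero] at this
        exact (smul_eq_zero.1 this.symm).resolve_left hc
      have := LinearMap.finrank_le_finrank_of_injective this
      omega
    have hsurj := surjective_of_le h₂ (by omega)
    have hi := injective_of_le h₄ (by omega)
    rw [Module.finrank_zero_iff (R := k)]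
    refine subsingleton_of_forall_eq 0 fun y => ?_
    obtain ⟨x, rfl⟩ := hsurj y
    have := hb x
    rwa [hc, zero_smul, map_eq_zero_iff _ e₁.symm.injective, map_eq_zero_iff _ e₃.symm.injective,
      map_eq_zero_iff _ hi] at this

end LinearAlgebra

/-! ### From representations to pencils -/

section Square

variable {k : Type u} [Field k] {X Y : QuiverRep k Q2}

lemma nonempty_iso_of_equiv (gb : space X b ≃ₗ[k] space Y b)
    (gm : space X minus ≃ₗ[k] space Y minus) (gp : space X plus ≃ₗ[k] space Y plus)
    (ge : space X e ≃ₗ[k] space Y e)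
    (h₁ : ∀ x, gm (arrowMap X Arrow.b_minus x) = arrowMap Y Arrow.b_minus (gb x))
    (h₂ : ∀ x, gp (arrowMap X Arrow.b_plus x) = arrowMap Y Arrow.b_plus (gb x))
    (h₃ : ∀ x, ge (arrowMap X Arrow.minus_e x) = arrowMap Y Arrow.minus_e (gm x))
    (h₄ : ∀ x, ge (arrowMap X Arrow.plus_e x) = arrowMap Y Arrow.plus_e (gp x)) :
    Nonempty (X ≅ Y) :=
  nonempty_iso (fun | b => gb | minus => gm | plus => gp | e => ge) (arrow_cases h₁ h₂ h₃ h₄)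

/-- A nonzero space is required because the endomorphisms of the zero representation are also
scalar, while its endomorphism space has dimension 0. -/
lemma finrank_end_eq_one_iff (v : Q2) (hv : 0 < dim X v) : Module.finrank k (X ⟶ X) = 1 ↔
    ∀ f : X ⟶ X, ∃ c : k, ∀ v x, component f v x = c • x := by
  have hid : (𝟙 X) ≠ 0 := fun h => by
    have : Nontrivial (space X v) := Module.finrank_pos_iff.1 hv
    obtain ⟨x, hx⟩ := exists_ne (0 : space X v)
    exact hx (LinearMap.congr_fun (congrArg (component · v) h) x)
  rw [finrank_eq_one_iff_of_nonzero' _ hid]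
  refine forall_congr' fun f => exists_congr fun c => ?_
  constructor
  · rintro rfl v x
    rfl
  · intro h
    exact hom_ext fun v x => (h v x).symm

variable (X) in
/-- The composite of the arrows of the path through `minus`. -/
def pathMinus : space X b →ₗ[k] space X e := arrowMap X Arrow.minus_e ∘ₗ arrowMap X Arrow.b_minus

variable (X) in
/-- The composite of the arrows of the path through `plus`. -/
def pathPlus : space X b →ₗ[k] space X e := arrowMap X Arrow.plus_e ∘ₗ arrowMap X Arrow.b_plus

variable (X) in
/-- Each of the two paths has an arrow acting by an isomorphism. -/
def Tight : Prop :=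
  (Function.Bijective (arrowMap X Arrow.b_minus) ∨ Function.Bijective (arrowMap X Arrow.minus_e)) ∧
  (Function.Bijective (arrowMap X Arrow.b_plus) ∨ Function.Bijective (arrowMap X Arrow.plus_e))

variable (X) in
/-- The two paths act as the pair `π₋`, `π₊`. -/
def HasPiForm (m : ℕ) : Prop :=
  ∃ (eb : space X b ≃ₗ[k] (Fin (m + 1) → k)) (ee : space X e ≃ₗ[k] (Fin m → k)), ∀ x,
    ee (pathMinus X x) = piMinus k m (eb x) ∧ ee (pathPlus X x) = piPlus k m (eb x)

variable (X) in
/-- The two paths act as the pair `j₋`, `j₊`. -/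
def HasJForm (m : ℕ) : Prop :=
  ∃ (eb : space X b ≃ₗ[k] (Fin m → k)) (ee : space X e ≃ₗ[k] (Fin (m + 1) → k)), ∀ x,
    ee (pathMinus X x) = jMinus k m (eb x) ∧ ee (pathPlus X x) = jPlus k m (eb x)

lemma component_pathMinus (f : X ⟶ X) (x : space X b) :
    component f e (pathMinus X x) = pathMinus X (component f b x) := by
  simp only [pathMinus, LinearMap.comp_apply, component_arrowMap]

lemma component_pathPlus (f : X ⟶ X) (x : space X b) :
    component f e (pathPlus X x) = pathPlus X (component f b x) := by
  simp only [pathPlus, LinearMap.comp_apply, component_arrowMap]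

/-- A bijective arrow identifies each middle space with the space at `b` or at `e`, so the scalar
there determines the action in the middle. -/
lemma Tight.component_eq_smul (h : Tight X) (f : X ⟶ X) {c : k}
    (hb : ∀ x, component f b x = c • x) (he : ∀ x, component f e x = c • x) (v : Q2)
    (x : space X v) : component f v x = c • x := by
  have src {w : Q2} (a : b ⟶ w) (ha : Function.Bijective (arrowMap X a)) (x) :
      component f w x = c • x := by
    obtain ⟨x, rfl⟩ := ha.2 x
    rw [component_arrowMap, hb, map_smul]
  have tgt {w : Q2} (a : w ⟶ e) (ha : Function.Bijective (arrowMap X a)) (x) :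
      component f w x = c • x := by
    apply ha.1
    rw [← component_arrowMap, he, map_smul]
  cases v
  · exact hb x
  · exact h.1.elim (fun ha => src _ ha x) (fun ha => tgt _ ha x)
  · exact h.2.elim (fun ha => src _ ha x) (fun ha => tgt _ ha x)
  · exact he x

lemma HasPiForm.exists_eq_smul {m : ℕ} (h : HasPiForm X m) (ht : Tight X) (f : X ⟶ X) :
    ∃ c : k, ∀ v x, component f v x = c • x := by
  obtain ⟨eb, ee, h⟩ := h
  obtain ⟨c, h₁, h₂⟩ := pi_end_scalar (m := m)
    (eb.toLinearMap ∘ₗ component f b ∘ₗ eb.symm.toLinearMap)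
    (ee.toLinearMap ∘ₗ component f e ∘ₗ ee.symm.toLinearMap)
    (fun x => by
      obtain ⟨x, rfl⟩ := eb.surjective x
      simp [← (h _).1, component_pathMinus])
    (fun x => by
      obtain ⟨x, rfl⟩ := eb.surjective x
      simp [← (h _).2, component_pathPlus])
  refine ⟨c, ht.component_eq_smul f (fun x => eb.injective ?_) (fun x => ee.injective ?_)⟩
  · simpa using h₁ (eb x)
  · simpa using h₂ (ee x)

lemma HasJForm.exists_eq_smul {m : ℕ} (h : HasJForm X m) (ht : Tight X) (f : X ⟶ X) :
    ∃ c : k, ∀ v x, component f v x = c • x := by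
  obtain ⟨eb, ee, h⟩ := h
  obtain ⟨c, h₁, h₂⟩ := j_end_scalar (m := m)
    (eb.toLinearMap ∘ₗ component f b ∘ₗ eb.symm.toLinearMap)
    (ee.toLinearMap ∘ₗ component f e ∘ₗ ee.symm.toLinearMap)
    (fun x => by
      obtain ⟨x, rfl⟩ := eb.surjective x
      simp [← (h _).1, component_pathMinus])
    (fun x => by
      obtain ⟨x, rfl⟩ := eb.surjective x
      simp [← (h _).2, component_pathPlus])
  refine ⟨c, ht.component_eq_smul f (fun x => eb.injective ?_) (fun x => ee.injective ?_)⟩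
  · simpa using h₁ (eb x)
  · simpa using h₂ (ee x)

variable (X Y) in
/-- Each of the two paths has an arrow acting by an isomorphism on both representations. -/
def Matched : Prop :=
  ((Function.Bijective (arrowMap X Arrow.b_minus) ∧ Function.Bijective (arrowMap Y Arrow.b_minus)) ∨
    (Function.Bijective (arrowMap X Arrow.minus_e) ∧
      Function.Bijective (arrowMap Y Arrow.minus_e))) ∧
  ((Function.Bijective (arrowMap X Arrow.b_plus) ∧ Function.Bijective (arrowMap Y Arrow.b_plus)) ∨
    (Function.Bijective (arrowMap X Arrow.plus_e) ∧ Function.Bijective (arrowMap Y Arrow.plus_e)))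

/-- When bijective arrows sit in the same places of `X` and `Y`, the middle spaces add nothing to
the pair of composites from `b` to `e`: an isomorphism of pencils extends uniquely to them. -/
lemma Matched.nonempty_iso (h : Matched X Y) (eb : space X b ≃ₗ[k] space Y b)
    (ee : space X e ≃ₗ[k] space Y e) (h₁ : ∀ x, ee (pathMinus X x) = pathMinus Y (eb x))
    (h₂ : ∀ x, ee (pathPlus X x) = pathPlus Y (eb x)) : Nonempty (X ≅ Y) := by
  obtain ⟨em, hm, hm'⟩ := exists_middle_equiv eb ee h₁ h.1
  obtain ⟨ep, hp, hp'⟩ := exists_middle_equiv eb ee h₂ h.2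
  exact nonempty_iso_of_equiv eb em ep ee hm hp hm' hp'

lemma HasPiForm.nonempty_iso {m : ℕ} (hX : HasPiForm X m) (hY : HasPiForm Y m)
    (h : Matched X Y) : Nonempty (X ≅ Y) := by
  obtain ⟨eb, ee, hX⟩ := hX
  obtain ⟨eb', ee', hY⟩ := hY
  exact h.nonempty_iso (eb ≪≫ₗ eb'.symm) (ee ≪≫ₗ ee'.symm)
    (fun x => ee'.injective (by simp [hX, hY])) (fun x => ee'.injective (by simp [hX, hY]))

lemma HasJForm.nonempty_iso {m : ℕ} (hX : HasJForm X m) (hY : HasJForm Y m)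
    (h : Matched X Y) : Nonempty (X ≅ Y) := by
  obtain ⟨eb, ee, hX⟩ := hX
  obtain ⟨eb', ee', hY⟩ := hY
  exact h.nonempty_iso (eb ≪≫ₗ eb'.symm) (ee ≪≫ₗ ee'.symm)
    (fun x => ee'.injective (by simp [hX, hY])) (fun x => ee'.injective (by simp [hX, hY]))

/-- The arrows of a rigid representation act by maps of maximal rank. -/
lemma Rigid.injective_or_surjective (h : Rigid X) (v w : Q2) (a : v ⟶ w) :
    Function.Injective (arrowMap X a) ∨ Function.Surjective (arrowMap X a) := by
  revert v w a
  refine arrow_cases ?_ ?_ ?_ ?_ <;> refine Q2.injective_or_surjective _ fun ψ => ?_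
  · obtain ⟨g, h₁, -, -, -⟩ := h ψ 0 0 0
    exact ⟨_, _, h₁⟩
  · obtain ⟨g, -, h₁, -, -⟩ := h 0 ψ 0 0
    exact ⟨_, _, h₁⟩
  · obtain ⟨g, -, -, h₁, -⟩ := h 0 0 ψ 0
    exact ⟨_, _, h₁⟩
  · obtain ⟨g, -, -, -, h₁⟩ := h 0 0 0 ψ
    exact ⟨_, _, h₁⟩

lemma Rigid.bijective (h : Rigid X) {v w : Q2} (a : v ⟶ w) (hd : dim X v = dim X w) :
    Function.Bijective (arrowMap X a) :=
  ⟨injective_of_le (h.injective_or_surjective v w a) hd.le,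
    surjective_of_le (h.injective_or_surjective v w a) hd.ge⟩

/-- A map between the ends of a path with a bijective arrow splits along the path. -/
lemma exists_split_of_bijective {V M W : Type*} [AddCommGroup V] [Module k V] [AddCommGroup M]
    [Module k M] [AddCommGroup W] [Module k W] {f : V →ₗ[k] M} {g : M →ₗ[k] W}
    (h : Function.Bijective f ∨ Function.Bijective g) (ψ : V →ₗ[k] W) :
    ∃ (φ : V →ₗ[k] M) (φ' : M →ₗ[k] W), ∀ x, g (φ x) + φ' (f x) = ψ x := by
  rcases h with h | h
  · refine ⟨0, ψ ∘ₗ (LinearEquiv.ofBijective f h).symm.toLinearMap, fun x => ?_⟩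
    have : (LinearEquiv.ofBijective f h).symm (f x) = x :=
      (LinearEquiv.ofBijective f h).symm_apply_apply x
    simp [this]
  · refine ⟨(LinearEquiv.ofBijective g h).symm.toLinearMap ∘ₗ ψ, 0, fun x => ?_⟩
    have : g ((LinearEquiv.ofBijective g h).symm (ψ x)) = ψ x :=
      (LinearEquiv.ofBijective g h).apply_symm_apply (ψ x)
    simp [this]

/-- A deformation of the combination splits into deformations of the two paths, and each of these is
carried by a single arrow because the other arrow of its path is bijective. Rigidity writes the
arrow deformations as commutators, which telescope along each path, so `Q2.injective_or_surjective`
applies. -/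
lemma Rigid.pencil (h : Rigid X) (ht : Tight X) (s t : k) (hst : s ≠ 0 ∨ t ≠ 0) :
    Function.Injective (s • pathMinus X + t • pathPlus X) ∨
      Function.Surjective (s • pathMinus X + t • pathPlus X) := by
  refine Q2.injective_or_surjective _ fun ψ => ?_
  obtain ⟨ψ₁, ψ₂, hψ⟩ : ∃ ψ₁ ψ₂ : space X b →ₗ[k] space X e, ∀ x, s • ψ₁ x + t • ψ₂ x = ψ x := by
    rcases hst with hs | ht
    · exact ⟨s⁻¹ • ψ, 0, fun x => by simp [smul_smul, hs]⟩
    · exact ⟨0, t⁻¹ • ψ, fun x => by simp [smul_smul, ht]⟩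
  obtain ⟨φ₁, φ₃, h₁⟩ := exists_split_of_bijective ht.1 ψ₁
  obtain ⟨φ₂, φ₄, h₂⟩ := exists_split_of_bijective ht.2 ψ₂
  obtain ⟨g, g₁, g₂, g₃, g₄⟩ := h φ₁ φ₂ φ₃ φ₄
  refine ⟨g b, g e, fun x => ?_⟩
  rw [← hψ, ← h₁, ← h₂, ← g₁, ← g₂, ← g₃, ← g₄]
  simp only [pathMinus, pathPlus, LinearMap.add_apply, LinearMap.smul_apply, LinearMap.comp_apply,
    map_add, map_smul, map_sub]
  module

lemma Rigid.hasPiForm [IsAlgClosed k] (h : Rigid X) (ht : Tight X)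
    (hd : dim X b = dim X e + 1) : HasPiForm X (dim X e) :=
  SurjectivePencil.exists_equiv (fun s t hst => surjective_of_le (h.pencil ht s t hst)
    (by unfold dim at hd; omega)) hd rfl

lemma Rigid.hasJForm [IsAlgClosed k] (h : Rigid X) (ht : Tight X)
    (hd : dim X e = dim X b + 1) : HasJForm X (dim X b) :=
  exists_equiv_of_injective (fun s t hst => injective_of_le (h.pencil ht s t hst)
    (by unfold dim at hd; omega)) rfl hd

end Square
-- The list is exceptional, complete and without repetition
section Classification

variable {k : Type u} [Field k]

@[simp] lemma dim_rep {αb αm αp αe : ℕ} (f₁ : (Fin αb → k) →ₗ[k] (Fin αm → k))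
    (f₂ : (Fin αb → k) →ₗ[k] (Fin αp → k)) (f₃ : (Fin αm → k) →ₗ[k] (Fin αe → k))
    (f₄ : (Fin αp → k) →ₗ[k] (Fin αe → k)) (v : Q2) :
    dim (rep αb αm αp αe f₁ f₂ f₃ f₄) v = dimAt αb αm αp αe v :=
  Module.finrank_fin_fun k

lemma dim_eq_of_iso {X Y : QuiverRep k Q2} (i : X ≅ Y) (v : Q2) : dim X v = dim Y v :=
  (FGModuleCat.isoToLinearEquiv (i.app ((Paths.of Q2).obj v))).finrank_eq

lemma isExceptional_of_iso {X Y : QuiverRep k Q2} (i : X ≅ Y) (h : IsExceptional k Y) :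
    IsExceptional k X := by
  rw [isExceptional_iff] at h ⊢
  simp only [dim_eq_of_iso i]
  exact ⟨(Linear.homCongr k i i).finrank_eq.trans h.1, h.2⟩

variable (k)

lemma excRep_hasPiForm (m : ℕ) : HasPiForm (E1 k m) m ∧ HasPiForm (E4 k m) m ∧
    HasPiForm (E6 k m) m ∧ HasPiForm (E7 k m) m := by
  refine ⟨?_, ?_, ?_, ?_⟩ <;>
  exact ⟨LinearEquiv.refl k (Fin (m + 1) → k), LinearEquiv.refl k (Fin m → k),
    fun _ => ⟨rfl, rfl⟩⟩

lemma excRep_hasJForm (m : ℕ) : HasJForm (E2 k m) m ∧ HasJForm (E3 k m) m ∧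
    HasJForm (E5 k m) m ∧ HasJForm (E8 k m) m := by
  refine ⟨?_, ?_, ?_, ?_⟩ <;>
  exact ⟨LinearEquiv.refl k (Fin m → k), LinearEquiv.refl k (Fin (m + 1) → k),
    fun _ => ⟨rfl, rfl⟩⟩

lemma excRep_end_scalar (a : ExcLabel) (f : excRep k a ⟶ excRep k a) :
    ∃ c : k, ∀ v x, component f v x = c • x := by
  have one (g : (Fin 1 → k) →ₗ[k] (Fin 1 → k)) : ∃ c : k, ∀ x, g x = c • x := by
    refine ⟨g 1 0, fun x => ?_⟩
    have : x = x 0 • 1 := by ext i; simp [Subsingleton.elim i 0]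
    conv_lhs => rw [this, map_smul]
    ext i
    simp [Subsingleton.elim i 0, mul_comm]
  have zero (x y : Fin 0 → k) : x = y := Subsingleton.elim _ _
  have bij (n : ℕ) : Function.Bijective (LinearMap.id : (Fin n → k) →ₗ[k] _) :=
    Function.bijective_id
  cases a with
  | E1 m => exact (excRep_hasPiForm k m).1.exists_eq_smul ⟨.inr (bij _), .inr (bij _)⟩ f
  | E2 m => exact (excRep_hasJForm k m).1.exists_eq_smul ⟨.inr (bij _), .inr (bij _)⟩ f
  | E3 m => exact (excRep_hasJForm k m).2.1.exists_eq_smul ⟨.inl (bij _), .inl (bij _)⟩ f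
  | E4 m => exact (excRep_hasPiForm k m).2.1.exists_eq_smul ⟨.inl (bij _), .inl (bij _)⟩ f
  | E5 m => exact (excRep_hasJForm k m).2.2.1.exists_eq_smul ⟨.inr (bij _), .inl (bij _)⟩ f
  | E6 m => exact (excRep_hasPiForm k m).2.2.1.exists_eq_smul ⟨.inr (bij _), .inl (bij _)⟩ f
  | E7 m => exact (excRep_hasPiForm k m).2.2.2.exists_eq_smul ⟨.inl (bij _), .inr (bij _)⟩ f
  | E8 m => exact (excRep_hasJForm k m).2.2.2.exists_eq_smul ⟨.inl (bij _), .inr (bij _)⟩ f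
  | FPlus =>
    obtain ⟨c, hc⟩ := one (component f plus)
    refine ⟨c, fun v x => ?_⟩
    cases v
    exacts [zero _ _, zero _ _, hc x, zero _ _]
  | FMinus =>
    obtain ⟨c, hc⟩ := one (component f minus)
    refine ⟨c, fun v x => ?_⟩
    cases v
    exacts [zero _ _, hc x, zero _ _, zero _ _]
  | GPlus =>
    obtain ⟨c, hc⟩ := one (component f b)
    refine ⟨c, fun v x => ?_⟩
    have hp (x : space (GPlus k) plus) : component f plus x = c • x :=
      (component_arrowMap f Arrow.b_plus x).trans (hc x)
    cases v
    exacts [hc x, zero _ _, hp x, (component_arrowMap f Arrow.plus_e x).trans (hp x)]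
  | GMinus =>
    obtain ⟨c, hc⟩ := one (component f b)
    refine ⟨c, fun v x => ?_⟩
    have hm (x : space (GMinus k) minus) : component f minus x = c • x :=
      (component_arrowMap f Arrow.b_minus x).trans (hc x)
    cases v
    exacts [hc x, hm x, zero _ _, (component_arrowMap f Arrow.minus_e x).trans (hm x)]

lemma exists_dim_excRep_pos (a : ExcLabel) : ∃ v, 0 < dim (excRep k a) v := by
  cases a with
  | E1 m | E4 m | E6 m | E7 m => exact ⟨b, by simp [excRep, E1, E4, E6, E7, dimAt]⟩
  | E2 m | E3 m | E5 m | E8 m => exact ⟨e, by simp [excRep, E2, E3, E5, E8, dimAt]⟩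
  | FPlus => exact ⟨plus, by simp [excRep, FPlus, dimAt]⟩
  | FMinus => exact ⟨minus, by simp [excRep, FMinus, dimAt]⟩
  | GPlus => exact ⟨b, by simp [excRep, GPlus, dimAt]⟩
  | GMinus => exact ⟨b, by simp [excRep, GMinus, dimAt]⟩

lemma isExceptional_excRep (a : ExcLabel) : IsExceptional k (excRep k a) := by
  obtain ⟨v, hv⟩ := exists_dim_excRep_pos k a
  refine (isExceptional_iff _).2
    ⟨(finrank_end_eq_one_iff v hv).2 (excRep_end_scalar k a), ?_⟩
  cases a <;>
    simp only [excRep, E1, E2, E3, E4, E5, E6, E7, E8, FPlus, FMinus, GPlus, GMinus, dim_rep,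
      dimAt] <;> ring

/-- The jumps in the dimension vector determine the family, and its size then determines the
parameter. -/
lemma excRep_injective {a a' : ExcLabel}
    (h : ∀ v, dim (excRep k a) v = dim (excRep k a') v) : a = a' := by
  have h₁ := h b
  have h₂ := h minus
  have h₃ := h plus
  have h₄ := h e
  cases a <;> cases a' <;>
    simp only [excRep, E1, E2, E3, E4, E5, E6, E7, E8, FPlus, FMinus, GPlus, GMinus, dim_rep,
      dimAt] at h₁ h₂ h₃ h₄ <;>
    first
    | rfl
    | exact congrArg _ (by omega)
    | omega

/-- The positive roots of the Tits form. -/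
lemma roots {p q r s : ℕ}
    (h : p ^ 2 + q ^ 2 + r ^ 2 + s ^ 2 = 1 + p * q + p * r + q * s + r * s) :
    (p = s + 1 ∧ (q = s ∨ q = p) ∧ (r = s ∨ r = p)) ∨
    (s = p + 1 ∧ (q = s ∨ q = p) ∧ (r = s ∨ r = p)) ∨
    (p = s ∧ q = p ∧ (r = p + 1 ∨ p = r + 1)) ∨
    (p = s ∧ r = p ∧ (q = p + 1 ∨ p = q + 1)) := by
  -- Twice the Tits form is a sum of four squares, so every difference is at most 1 in absolute
  -- value and exactly two are nonzero. The final case check uses that both paths have the same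
  -- total difference `p - s`.
  have h' : ((p : ℤ) - q) ^ 2 + ((p : ℤ) - r) ^ 2 + ((q : ℤ) - s) ^ 2 + ((r : ℤ) - s) ^ 2 = 2 := by
    zify at h
    linear_combination 2 * h
  have small {x : ℤ} (hx : x ^ 2 ≤ 2) : x = -1 ∨ x = 0 ∨ x = 1 := by
    have : x ≤ 1 := by nlinarith
    have : -1 ≤ x := by nlinarith
    omega
  have s₁ := sq_nonneg ((p : ℤ) - q)
  have s₂ := sq_nonneg ((p : ℤ) - r)
  have s₃ := sq_nonneg ((q : ℤ) - s)
  have s₄ := sq_nonneg ((r : ℤ) - s)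
  have c₁ := small (x := (p : ℤ) - q) (by linarith)
  have c₂ := small (x := (p : ℤ) - r) (by linarith)
  have c₃ := small (x := (q : ℤ) - s) (by linarith)
  have c₄ := small (x := (r : ℤ) - s) (by linarith)
  clear h s₁ s₂ s₃ s₄ small
  rcases c₁ with h₁ | h₁ | h₁ <;> rcases c₂ with h₂ | h₂ | h₂ <;>
    rcases c₃ with h₃ | h₃ | h₃ <;> rcases c₄ with h₄ | h₄ | h₄ <;>
    rw [h₁, h₂, h₃, h₄] at h' <;> omega

variable {k} {X : QuiverRep k Q2}

/-- On each path the dimension drops at exactly one arrow and the other arrow is bijective. The two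
choices for each path give `E1`, `E6`, `E7` and `E4`. -/
lemma Rigid.exists_iso_of_pi [IsAlgClosed k] (h : Rigid X) (hd : dim X b = dim X e + 1)
    (hm : dim X minus = dim X e ∨ dim X minus = dim X b)
    (hp : dim X plus = dim X e ∨ dim X plus = dim X b) :
    ∃ a : ExcLabel, Nonempty (X ≅ excRep k a) := by
  have bij (n : ℕ) : Function.Bijective (LinearMap.id : (Fin n → k) →ₗ[k] _) :=
    Function.bijective_id
  have hX : HasPiForm X (dim X e) := h.hasPiForm
    ⟨hm.symm.imp (fun hm => h.bijective _ hm.symm) (fun hm => h.bijective _ hm),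
      hp.symm.imp (fun hp => h.bijective _ hp.symm) (fun hp => h.bijective _ hp)⟩ hd
  have hY := excRep_hasPiForm k (dim X e)
  rcases hm with hm | hm <;> rcases hp with hp | hp
  · exact ⟨.E1 (dim X e), hX.nonempty_iso hY.1
      ⟨.inr ⟨h.bijective _ hm, bij _⟩, .inr ⟨h.bijective _ hp, bij _⟩⟩⟩
  · exact ⟨.E6 (dim X e), hX.nonempty_iso hY.2.2.1
      ⟨.inr ⟨h.bijective _ hm, bij _⟩, .inl ⟨h.bijective _ hp.symm, bij _⟩⟩⟩
  · exact ⟨.E7 (dim X e), hX.nonempty_iso hY.2.2.2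
      ⟨.inl ⟨h.bijective _ hm.symm, bij _⟩, .inr ⟨h.bijective _ hp, bij _⟩⟩⟩
  · exact ⟨.E4 (dim X e), hX.nonempty_iso hY.2.1
      ⟨.inl ⟨h.bijective _ hm.symm, bij _⟩, .inl ⟨h.bijective _ hp.symm, bij _⟩⟩⟩

/-- The case dual to `Rigid.exists_iso_of_pi`: the dimension rises once on each path, giving `E2`,
`E5`, `E8` and `E3`. -/
lemma Rigid.exists_iso_of_j [IsAlgClosed k] (h : Rigid X) (hd : dim X e = dim X b + 1)
    (hm : dim X minus = dim X e ∨ dim X minus = dim X b)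
    (hp : dim X plus = dim X e ∨ dim X plus = dim X b) :
    ∃ a : ExcLabel, Nonempty (X ≅ excRep k a) := by
  have bij (n : ℕ) : Function.Bijective (LinearMap.id : (Fin n → k) →ₗ[k] _) :=
    Function.bijective_id
  have hX : HasJForm X (dim X b) := h.hasJForm
    ⟨hm.symm.imp (fun hm => h.bijective _ hm.symm) (fun hm => h.bijective _ hm),
      hp.symm.imp (fun hp => h.bijective _ hp.symm) (fun hp => h.bijective _ hp)⟩ hd
  have hY := excRep_hasJForm k (dim X b)
  rcases hm with hm | hm <;> rcases hp with hp | hp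
  · exact ⟨.E2 (dim X b), hX.nonempty_iso hY.1
      ⟨.inr ⟨h.bijective _ hm, bij _⟩, .inr ⟨h.bijective _ hp, bij _⟩⟩⟩
  · exact ⟨.E5 (dim X b), hX.nonempty_iso hY.2.2.1
      ⟨.inr ⟨h.bijective _ hm, bij _⟩, .inl ⟨h.bijective _ hp.symm, bij _⟩⟩⟩
  · exact ⟨.E8 (dim X b), hX.nonempty_iso hY.2.2.2
      ⟨.inl ⟨h.bijective _ hm.symm, bij _⟩, .inr ⟨h.bijective _ hp, bij _⟩⟩⟩
  · exact ⟨.E3 (dim X b), hX.nonempty_iso hY.2.1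
      ⟨.inl ⟨h.bijective _ hm.symm, bij _⟩, .inl ⟨h.bijective _ hp.symm, bij _⟩⟩⟩

/-- A family of linear maps at the vertices commuting with the arrows is scalar if all
endomorphisms are. -/
lemma scalar_of_end_scalar (h : ∀ f : X ⟶ X, ∃ c : k, ∀ v x, component f v x = c • x)
    (gb : space X b →ₗ[k] space X b) (gm : space X minus →ₗ[k] space X minus)
    (gp : space X plus →ₗ[k] space X plus) (ge : space X e →ₗ[k] space X e)
    (h₁ : ∀ x, gm (arrowMap X Arrow.b_minus x) = arrowMap X Arrow.b_minus (gb x))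
    (h₂ : ∀ x, gp (arrowMap X Arrow.b_plus x) = arrowMap X Arrow.b_plus (gb x))
    (h₃ : ∀ x, ge (arrowMap X Arrow.minus_e x) = arrowMap X Arrow.minus_e (gm x))
    (h₄ : ∀ x, ge (arrowMap X Arrow.plus_e x) = arrowMap X Arrow.plus_e (gp x)) :
    ∃ c : k, ∀ v x, family X (gb, gm, gp, ge) v x = c • x :=
  h (homMk (family X (gb, gm, gp, ge)) (arrow_cases h₁ h₂ h₃ h₄))

lemma subsingleton_of_dim_eq_zero {v : Q2} (h : dim X v = 0) : Subsingleton (space X v) :=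
  (Module.finrank_zero_iff (R := k)).1 h

/-- Two spaces of the same dimension are isomorphic. -/
lemma nonempty_equiv {Y : QuiverRep k Q2} {v : Q2} (h : dim X v = dim Y v) :
    Nonempty (space X v ≃ₗ[k] space Y v) :=
  FiniteDimensional.nonempty_linearEquiv_of_finrank_eq h

/-- The path through `minus` is invertible, so `middle_degenerate` makes the smaller of the
dimensions at `b` and `plus` zero. Either only the space at `plus` survives, as a line (`FPlus`), or
it vanishes and the other three are lines joined by isomorphisms (`GMinus`). -/
lemma Rigid.exists_iso_of_minus (h : Rigid X)
    (hs : ∀ f : X ⟶ X, ∃ c : k, ∀ v x, component f v x = c • x) (hbe : dim X b = dim X e)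
    (hm : dim X minus = dim X b) (hp : dim X plus = dim X b + 1 ∨ dim X b = dim X plus + 1) :
    ∃ a : ExcLabel, Nonempty (X ≅ excRep k a) := by
  obtain ⟨hF, hG⟩ := middle_degenerate
    (fun gb gm gp ge h₁ h₂ h₃ h₄ => by
      obtain ⟨c, hc⟩ := scalar_of_end_scalar hs gb gm gp ge h₁ h₂ h₃ h₄
      exact ⟨c, hc b, hc plus⟩)
    (h.bijective Arrow.b_minus hm.symm) (h.bijective Arrow.minus_e (hm.trans hbe))
    (h.injective_or_surjective _ _ Arrow.b_plus) (h.injective_or_surjective _ _ Arrow.plus_e)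
  rcases hp with hp | hp
  · have h0 : dim X b = 0 := hF hp
    refine ⟨.FPlus, ?_⟩
    obtain ⟨eb⟩ := nonempty_equiv (X := X) (Y := FPlus k) (v := b) (by simp [FPlus, dimAt, h0])
    obtain ⟨em⟩ := nonempty_equiv (X := X) (Y := FPlus k) (v := minus)
      (by simp [FPlus, dimAt, h0, hm])
    obtain ⟨ep⟩ := nonempty_equiv (X := X) (Y := FPlus k) (v := plus)
      (by simp [FPlus, dimAt, h0, hp])
    obtain ⟨ee⟩ := nonempty_equiv (X := X) (Y := FPlus k) (v := e)
      (by simp [FPlus, dimAt, h0, ← hbe])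
    have := subsingleton_of_dim_eq_zero h0
    have zero (x y : Fin 0 → k) : x = y := Subsingleton.elim _ _
    refine nonempty_iso_of_equiv eb em ep ee (fun x => zero _ _) (fun x => ?_) (fun x => zero _ _)
      (fun x => zero _ _)
    rw [Subsingleton.elim x 0, map_zero]
    exact map_zero ep
  · have h0 : dim X plus = 0 := hG hp
    refine ⟨.GMinus, ?_⟩
    obtain ⟨eb⟩ := nonempty_equiv (X := X) (Y := GMinus k) (v := b)
      (by simp [GMinus, dimAt, h0, hp])
    obtain ⟨ep⟩ := nonempty_equiv (X := X) (Y := GMinus k) (v := plus)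
      (by simp [GMinus, dimAt, h0])
    let em := (LinearEquiv.ofBijective _ (h.bijective Arrow.b_minus hm.symm)).symm ≪≫ₗ eb
    let ee := (LinearEquiv.ofBijective _ (h.bijective Arrow.minus_e (hm.trans hbe))).symm ≪≫ₗ em
    have := subsingleton_of_dim_eq_zero h0
    have zero (x y : Fin 0 → k) : x = y := Subsingleton.elim _ _
    refine nonempty_iso_of_equiv (Y := GMinus k) eb em ep ee (fun x => ?_) (fun x => zero _ _)
      (fun x => ?_) (fun x => ?_)
    · exact congrArg eb ((LinearEquiv.ofBijective _
        (h.bijective Arrow.b_minus hm.symm)).symm_apply_apply x)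
    · exact congrArg em ((LinearEquiv.ofBijective _
        (h.bijective Arrow.minus_e (hm.trans hbe))).symm_apply_apply x)
    · rw [Subsingleton.elim x 0, map_zero]
      exact map_zero ee

lemma Rigid.exists_iso_of_plus (h : Rigid X)
    (hs : ∀ f : X ⟶ X, ∃ c : k, ∀ v x, component f v x = c • x) (hbe : dim X b = dim X e)
    (hp : dim X plus = dim X b) (hm : dim X minus = dim X b + 1 ∨ dim X b = dim X minus + 1) :
    ∃ a : ExcLabel, Nonempty (X ≅ excRep k a) := by
  obtain ⟨hF, hG⟩ := middle_degenerate
    -- The middle vertices exchange roles, since the invertible path now runs through `plus`.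
    (fun gb gp gm ge h₁ h₂ h₃ h₄ => by
      obtain ⟨c, hc⟩ := scalar_of_end_scalar hs gb gm gp ge h₂ h₁ h₄ h₃
      exact ⟨c, hc b, hc minus⟩)
    (h.bijective Arrow.b_plus hp.symm) (h.bijective Arrow.plus_e (hp.trans hbe))
    (h.injective_or_surjective _ _ Arrow.b_minus) (h.injective_or_surjective _ _ Arrow.minus_e)
  rcases hm with hm | hm
  · have h0 : dim X b = 0 := hF hm
    refine ⟨.FMinus, ?_⟩
    obtain ⟨eb⟩ := nonempty_equiv (X := X) (Y := FMinus k) (v := b) (by simp [FMinus, dimAt, h0])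
    obtain ⟨em⟩ := nonempty_equiv (X := X) (Y := FMinus k) (v := minus)
      (by simp [FMinus, dimAt, h0, hm])
    obtain ⟨ep⟩ := nonempty_equiv (X := X) (Y := FMinus k) (v := plus)
      (by simp [FMinus, dimAt, h0, hp])
    obtain ⟨ee⟩ := nonempty_equiv (X := X) (Y := FMinus k) (v := e)
      (by simp [FMinus, dimAt, h0, ← hbe])
    have := subsingleton_of_dim_eq_zero h0
    have zero (x y : Fin 0 → k) : x = y := Subsingleton.elim _ _
    refine nonempty_iso_of_equiv eb em ep ee (fun x => ?_) (fun x => zero _ _) (fun x => zero _ _)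
      (fun x => zero _ _)
    rw [Subsingleton.elim x 0, map_zero]
    exact map_zero em
  · have h0 : dim X minus = 0 := hG hm
    refine ⟨.GPlus, ?_⟩
    obtain ⟨eb⟩ := nonempty_equiv (X := X) (Y := GPlus k) (v := b)
      (by simp [GPlus, dimAt, h0, hm])
    obtain ⟨em⟩ := nonempty_equiv (X := X) (Y := GPlus k) (v := minus)
      (by simp [GPlus, dimAt, h0])
    let ep := (LinearEquiv.ofBijective _ (h.bijective Arrow.b_plus hp.symm)).symm ≪≫ₗ eb
    let ee := (LinearEquiv.ofBijective _ (h.bijective Arrow.plus_e (hp.trans hbe))).symm ≪≫ₗ ep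
    have := subsingleton_of_dim_eq_zero h0
    have zero (x y : Fin 0 → k) : x = y := Subsingleton.elim _ _
    refine nonempty_iso_of_equiv (Y := GPlus k) eb em ep ee (fun x => zero _ _) (fun x => ?_)
      (fun x => ?_) (fun x => ?_)
    · exact congrArg eb ((LinearEquiv.ofBijective _
        (h.bijective Arrow.b_plus hp.symm)).symm_apply_apply x)
    · rw [Subsingleton.elim x 0, map_zero]
      exact map_zero ee
    · exact congrArg ep ((LinearEquiv.ofBijective _
        (h.bijective Arrow.plus_e (hp.trans hbe))).symm_apply_apply x)

lemma _root_.IsExceptional.exists_iso_excRep [IsAlgClosed k] (h : IsExceptional k X) :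
    ∃ a : ExcLabel, Nonempty (X ≅ excRep k a) := by
  have hr := ((isExceptional_iff_rigid X).1 h).2
  obtain ⟨hend, hroot⟩ := (isExceptional_iff X).1 h
  have hdim : ∃ v, 0 < dim X v := by
    -- The zero dimension vector would turn the Tits equation into `0 = 1`.
    by_contra! hd
    simp [Nat.le_zero.1 (hd _)] at hroot
  obtain ⟨v, hv⟩ := hdim
  have hs := (finrank_end_eq_one_iff v hv).1 hend
  obtain ⟨hbe, hm, hp⟩ | ⟨hbe, hm, hp⟩ | ⟨hbe, hm, hp⟩ | ⟨hbe, hp, hm⟩ := roots hroot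
  · exact hr.exists_iso_of_pi hbe hm hp
  · exact hr.exists_iso_of_j hbe hm hp
  · exact hr.exists_iso_of_minus hs hbe hm hp
  · exact hr.exists_iso_of_plus hs hbe hp hm

end Classification
end Q2

theorem mainTheorem9 (k : Type u) [Field k] [IsAlgClosed k] :
    (∀ X : QuiverRep k Q2,
      IsExceptional k X ↔ ∃ a : Q2.ExcLabel, Nonempty (X ≅ Q2.excRep k a)) ∧
    (∀ a b : Q2.ExcLabel, Nonempty (Q2.excRep k a ≅ Q2.excRep k b) → a = b) := by
  refine ⟨fun X => ⟨fun h => h.exists_iso_excRep, ?_⟩, ?_⟩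
  · rintro ⟨a, ⟨i⟩⟩
    exact Q2.isExceptional_of_iso i (Q2.isExceptional_excRep k a)
  · rintro a a' ⟨i⟩
    exact Q2.excRep_injective k (Q2.dim_eq_of_iso i)
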